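/- Let $k$ be a field, $S=k[x_1,\dots,x_n]$, let $\prec$ be a monomial order on $S$ refining the total degree with $x_1\succ x_2\succ\dots\succ x_n$ (for example degree-lex), and let $\mathfrak a\subset S$ be an ideal that has a quadratic Gröbner basis with respect to $\prec$, i.e. a Gröbner basis consisting of homogeneous polynomials of degree $2$. Put $A=S/\mathfrak a$, let $\mathfrak m=\langle x_1,\dots,x_n\rangle\subset A$, and identify $k=A/\mathfrak m$. Let $\mathcal G$ be the set of standard monomials of degree $\ge 1$. Let $\mathbf{NB}_\bullet$ be the normalized bar resolution of $k$ over $A$: it is $A$-free on the cells $[w_1|\dots|w_l]$ with $w_i\in\mathcal G$, in homological degree $l\ge 0$, with $$\partial[w_1|\dots|w_l]=w_1[w_2|\dots|w_l]+\sum_{j=1}^{l-1}(-1)^j\sum_{v\in\mathcal G}a_{j,v}[w_1|\dots|w_{j-1}|v|w_{j+2}|\dots|w_l]\quad(l\ge1),$$ where $a_{j,v}\in k$ is the coefficient of $v$ in the normal form of $w_jw_{j+1}$. Write $[c:c']$ for the coefficient of the cell $c'$ in $\partial c$, and consider the directed graph on the cells with an edge $c\to c'$ whenever $[c:c']\ne0$.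 Define sets $\mathcal M_1,\mathcal M_2,\dots$ of edges as follows. $\mathcal M_1$ consists of the edges $[x_{m(w)}|w'|w_2|\dots]\to[w|w_2|\dots]$ with $w=x_{m(w)}w'$, where $m(w)=\min\{i: x_i\mid w\}$. For $j\ge2$ let $\mathcal B_{j-1}$ be the set of cells on no edge of $\mathcal M_1\cup\dots\cup\mathcal M_{j-1}$; then $\mathcal M_j$ consists of the edges $[p|u_1|u_2|q]\to[p|u_1u_2|q]$ between cells of $\mathcal B_{j-1}$, where $p$ is a sequence of length $j-1$ and $q$ is any sequence, such that $u_1$ is the $\prec$-largest divisor $u$ of $w=u_1u_2$ with $[p|u|w/u|q]\in\mathcal B_{j-1}$ and $[p|v|w/v|q]\notin\mathcal B_{j-1}$ for every proper divisor $v$ of $u$. Let $\mathcal M=\bigcup_j\mathcal M_j$. A cell is critical if it lies on no edge of $\mathcal M$. Let $G_{\mathcal M}$ be the graph obtained by reversing the edges in $\mathcal M$, a reversed edge $c'\to c$ having weight $-1/[c:c']$ and every other edge $c\to c'$ having weight $[c:c']$. Then $\mathcal M$ is an acyclic matching (each cell lies on at most one edge of $\mathcal M$, the coefficients $[c:c']$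 along $\mathcal M$ are units, and $G_{\mathcal M}$ has no directed cycle), and from each cell there start only finitely many directed paths in $G_{\mathcal M}$. Let $F_\bullet$ be the Morse complex: $F_i$ is the free $A$-module on the critical cells of homological degree $i$, and $\partial c=\sum_{c'}\Gamma(c,c')\,c'$, where $c'$ runs over the critical cells of degree $i-1$ and $\Gamma(c,c')$ is the sum, over all directed paths from $c$ to $c'$ in $G_{\mathcal M}$, of the products of the weights of their edges. Then $F_\bullet$, with the augmentation $F_0\to k$, $[\,]\mapsto1$, is a minimal free resolution of $k$ over $A$: the sequence $\cdots\to F_2\to F_1\to F_0\to k\to0$ is exact, and $\partial F_{i+1}\subseteq\mathfrak m F_i$ for all $i\ge 0$. -/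

import Mathlib

open scoped MonomialOrder

noncomputable section

/-! ## Algebraic discrete Morse theory

A based complex of free `R`-modules is given by the set `C` of all its basis elements ("cells") and
by `D : C → C →₀ R`, the differential of a cell; so `D c c'` is the coefficient `[c : c']`. -/

namespace AlgMorse

variable {C R : Type*} [CommRing R]

/-- The edges of the graph `G_M`: the edges `c ⟶ c'` of `G` (those with `[c : c'] ≠ 0`) that are not
in the matching, and the reversed edges of the matching.
`M c c'` means that the edge `c ⟶ c'` belongs to the matching. -/
def Step (D : C → C →₀ R) (M : C → C → Prop) (c c' : C) : Prop :=
  (D c c' ≠ 0 ∧ ¬ M c c') ∨ M c' c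

/-- `M` is an acyclic matching on the graph of the based complex. -/
structure IsAcyclicMatching (D : C → C →₀ R) (M : C → C → Prop) : Prop where
  edge : ∀ c c', M c c' → D c c' ≠ 0
  matching : ∀ v a b a' b', M a b → M a' b' → (v = a ∨ v = b) → (v = a' ∨ v = b') → a = a' ∧ b = b'
  invertible : ∀ c c', M c c' → IsUnit (D c c')
  acyclic : ∀ c, ¬ Relation.TransGen (Step D M) c c

/-- A cell is critical if it lies on no edge of the matching. -/
def IsCritical (M : C → C → Prop) (c : C) : Prop :=
  ∀ c', ¬ M c c' ∧ ¬ M c' c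

/-- The list of cells `p` is a (directed) path in the graph `G_M`; paths consist of at least one cell
as soon as a starting point is prescribed, and the one-cell path is allowed. -/
def IsPath (D : C → C →₀ R) (M : C → C → Prop) (p : List C) : Prop :=
  p.IsChain (Step D M)

open Classical in
/-- The weight of a step: `-1/[c' : c]` along a reversed edge of the matching, `[c : c']` else. -/
def stepWeight (D : C → C →₀ R) (M : C → C → Prop) (c c' : C) : R :=
  if M c' c then - Ring.inverse (D c' c) else D c c'

/-- The weight of a path: the product of the weights of its steps. -/
def pathWeight (D : C → C →₀ R) (M : C → C → Prop) : List C → R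
  | c :: c' :: p => stepWeight D M c c' * pathWeight D M (c' :: p)
  | _ => 1

/-- `Γ(c, c')`: the sum of the weights of all paths from `c` to `c'`. -/
def Gam (D : C → C →₀ R) (M : C → C → Prop) (c c' : C) : R :=
  ∑ᶠ p ∈ {p : List C | IsPath D M p ∧ p.head? = some c ∧ p.getLast? = some c'}, pathWeight D M p

/-- The critical cells of homological degree `i`. -/
abbrev CriticalCell (M : C → C → Prop) (deg : C → ℕ) (i : ℕ) : Type _ :=
  {c : C // IsCritical M c ∧ deg c = i}

/-- The module in degree `i` of the Morse complex: free on the critical cells of degree `i`. -/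
abbrev MorseModule (R : Type*) [CommRing R] (M : C → C → Prop) (deg : C → ℕ) (i : ℕ) : Type _ :=
  CriticalCell M deg i →₀ R

/-- The Morse differential `c ↦ ∑ Γ(c, c') c'`, the sum being over the critical cells `c'` of degree
one less. -/
def morseD (D : C → C →₀ R) (M : C → C → Prop) (deg : C → ℕ) (i : ℕ) :
    MorseModule R M deg (i + 1) →ₗ[R] MorseModule R M deg i :=
  Finsupp.linearCombination R fun c : CriticalCell M deg (i + 1) =>
    ∑ᶠ c' : CriticalCell M deg i, Finsupp.single c' (Gam D M c.1 c'.1)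

end AlgMorse

/-! ## Gröbner bases and normal forms -/

namespace CommAnick

variable {k : Type*} [Field k] {n : ℕ}

/-- The monomial order refines the total degree. -/
def IsDegreeOrder (m : MonomialOrder (Fin n)) : Prop :=
  ∀ u v : Fin n →₀ ℕ, u.degree < v.degree → u ≺[m] v

/-- `B` is a Gröbner basis of `a`: it is contained in `a` and its leading terms generate the initial
ideal of `a`. -/
def IsGroebnerBasis (m : MonomialOrder (Fin n)) (B : Set (MvPolynomial (Fin n) k))
    (a : Ideal (MvPolynomial (Fin n) k)) : Prop :=
  B ⊆ a ∧ Ideal.span (m.leadingTerm '' B) =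
    Ideal.span (m.leadingTerm '' (a : Set (MvPolynomial (Fin n) k)))

/-- The monomial with exponent `v` is standard: it is not the leading monomial of an element
of `a`. -/
def IsStandard (m : MonomialOrder (Fin n)) (a : Ideal (MvPolynomial (Fin n) k))
    (v : Fin n →₀ ℕ) : Prop :=
  ∀ f ∈ a, f ≠ 0 → m.degree f ≠ v

theorem exists_normalForm (m : MonomialOrder (Fin n)) (a : Ideal (MvPolynomial (Fin n) k))
    (f : MvPolynomial (Fin n) k) :
    ∃ r : MvPolynomial (Fin n) k, f - r ∈ a ∧ ∀ v ∈ r.support, IsStandard m a v := by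
  obtain ⟨g, r, hf, -, hr⟩ := MonomialOrder.div_set (m := m)
    (B := {b : MvPolynomial (Fin n) k | b ∈ a ∧ b ≠ 0})
    (fun b hb => (MonomialOrder.leadingCoeff_ne_zero_iff.2 hb.2).isUnit) f
  refine ⟨r, ?_, fun v hv h ha h0 hd => hr v hv h ⟨ha, h0⟩ hd.le⟩
  rw [hf, add_sub_cancel_right, Finsupp.linearCombination_apply]
  exact a.sum_mem fun b _ => a.mul_mem_left _ b.2.1

/-- The normal form of `f`: the linear combination of standard monomials congruent to `f`
modulo `a`. -/
def normalForm (m : MonomialOrder (Fin n)) (a : Ideal (MvPolynomial (Fin n) k))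
    (f : MvPolynomial (Fin n) k) : MvPolynomial (Fin n) k :=
  (exists_normalForm m a f).choose

/-- The normal form is determined by its two defining properties. -/
theorem eq_normalForm (m : MonomialOrder (Fin n)) (a : Ideal (MvPolynomial (Fin n) k))
    (f r : MvPolynomial (Fin n) k) (h1 : f - r ∈ a) (h2 : ∀ v ∈ r.support, IsStandard m a v) :
    r = normalForm m a f := by
  obtain ⟨g1, g2⟩ := (exists_normalForm m a f).choose_spec
  change f - normalForm m a f ∈ a at g1
  change ∀ v ∈ (normalForm m a f).support, IsStandard m a v at g2
  by_contra hne
  have hne : r - normalForm m a f ≠ 0 := sub_ne_zero.2 hne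
  have hmem : r - normalForm m a f ∈ a := by
    have := a.sub_mem g1 h1
    simpa using this
  have hs := (MonomialOrder.degree_mem_support_iff (m := m) _).2 hne
  classical
  rcases Finset.mem_union.1 (MvPolynomial.support_sub (Fin n) _ _ hs) with h | h
  · exact h2 _ h _ hmem hne rfl
  · exact g2 _ h _ hmem hne rfl

/-! ## The normalized bar resolution -/

/-- The set `𝒢` of standard monomials of degree at least one (written as exponents). -/
abbrev StdMon (m : MonomialOrder (Fin n)) (a : Ideal (MvPolynomial (Fin n) k)) : Type :=
  {v : Fin n →₀ ℕ // v ≠ 0 ∧ IsStandard m a v}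

/-- The cells `[w₁|…|w_l]` of the normalized bar resolution; the homological degree is the length. -/
abbrev Cell (m : MonomialOrder (Fin n)) (a : Ideal (MvPolynomial (Fin n) k)) : Type :=
  List (StdMon m a)

/-- The quotient algebra `A`. -/
abbrev QuotAlg (a : Ideal (MvPolynomial (Fin n) k)) : Type _ := MvPolynomial (Fin n) k ⧸ a

/-- The ideal of `A` generated by the residue classes of the variables. -/
def maxIdeal (a : Ideal (MvPolynomial (Fin n) k)) : Ideal (QuotAlg a) :=
  Ideal.span (Set.range fun i : Fin n => Ideal.Quotient.mk a (MvPolynomial.X i))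

variable (m : MonomialOrder (Fin n)) (a : Ideal (MvPolynomial (Fin n) k))

open Classical in
/-- The inner part of the bar differential of `[w₁|…|w_l]`,
`∑_{1 ≤ j < l} (-1)^j ∑_{v ∈ 𝒢} a_{j,v} [w₁|…|w_{j-1}|v|w_{j+2}|…|w_l]`, where `a_{j,v}` is the
coefficient of `v` in the normal form of `w_j w_{j+1}`. -/
def mergeD : Cell m a → Cell m a →₀ QuotAlg a
  | w :: w' :: c =>
      - (∑ v ∈ (normalForm m a (MvPolynomial.monomial (w.1 + w'.1) 1)).support.subtype
            (fun v => v ≠ 0 ∧ IsStandard m a v),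
          Finsupp.single (v :: c) (algebraMap k (QuotAlg a)
            ((normalForm m a (MvPolynomial.monomial (w.1 + w'.1) 1)).coeff v.1)))
      - (mergeD (w' :: c)).mapDomain (fun c' => w :: c')
  | _ => 0

/-- The differential of the normalized bar resolution on cells:
`∂[w₁|…|w_l] = w₁[w₂|…|w_l] + (inner part)`. -/
def barD : Cell m a → Cell m a →₀ QuotAlg a
  | [] => 0
  | w :: c =>
      Finsupp.single c (Ideal.Quotient.mk a (MvPolynomial.monomial w.1 1)) + mergeD m a (w :: c)

/-! ## The matching -/

/-- The first matching: `[x_{m(w)}|w'|…] ⟶ [w|…]` for `w = x_{m(w)} w'`, where `m(w)` is the least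
index of a variable dividing `w`. -/
def firstMatching (c c' : Cell m a) : Prop :=
  ∃ (x w' w : StdMon m a) (q : Cell m a) (i : Fin n),
    c = x :: w' :: q ∧ c' = w :: q ∧ barD m a c c' ≠ 0 ∧
    IsLeast {j : Fin n | w.1 j ≠ 0} i ∧ x.1 = Finsupp.single i 1 ∧ w.1 = x.1 + w'.1

/-- With `p = [w₁|…|w_{j-1}]` and `q = [w_{j+1}|…|w_l]`: the monomial `u` divides `w`, the cell
`[p|u|w/u|q]` belongs to `S`, and for no proper divisor `v` of `u` does `[p|v|w/v|q]` belong
to `S`. -/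
def IsSplitting (S : Set (Cell m a)) (p : Cell m a) (w : StdMon m a) (q : Cell m a)
    (u : StdMon m a) : Prop :=
  (∃ u' : StdMon m a, w.1 = u.1 + u'.1 ∧ p ++ u :: u' :: q ∈ S) ∧
  ∀ v v' : StdMon m a, v.1 ≤ u.1 → v ≠ u → w.1 = v.1 + v'.1 → p ++ v :: v' :: q ∉ S

/-- The matching in the coordinate position following the first `j` ones, on the cells in `S`: the
edges `[p|u₁|u₂|q] ⟶ [p|u₁u₂|q]` between cells of `S` such that `u₁` is maximal with respect to the
monomial order among the `u` as in `IsSplitting`. -/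
def laterMatching (j : ℕ) (S : Set (Cell m a)) (c c' : Cell m a) : Prop :=
  ∃ (p q : Cell m a) (u₁ u₂ w : StdMon m a),
    p.length = j ∧ c = p ++ u₁ :: u₂ :: q ∧ c' = p ++ w :: q ∧ w.1 = u₁.1 + u₂.1 ∧
    barD m a c c' ≠ 0 ∧ c ∈ S ∧ c' ∈ S ∧
    IsSplitting m a S p w q u₁ ∧ ∀ u, IsSplitting m a S p w q u → u.1 ≼[m] u₁.1

/-- The matching in coordinate position `j + 1`, if `S` is the set of cells that are critical after
the positions `1, …, j`. -/
def matchingAt : ℕ → Set (Cell m a) → Cell m a → Cell m a → Prop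
  | 0, _ => firstMatching m a
  | j + 1, S => laterMatching m a (j + 1) S

/-- The cells that are critical after the matchings in the coordinate positions `1, …, j`. -/
def remaining : ℕ → Set (Cell m a)
  | 0 => Set.univ
  | j + 1 => {c ∈ remaining j |
      AlgMorse.IsCritical (matchingAt m a j (remaining j)) c}

/-- The union `ℳ` of all these matchings. -/
def matching (c c' : Cell m a) : Prop :=
  ∃ j, matchingAt m a j (remaining m a j) c c'

/-! ## The resolution -/

/-- The module `F_i`: the degree `i` part of the Morse complex of the normalized bar resolution with
respect to `ℳ`. -/
abbrev F (i : ℕ) : Type _ :=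
  AlgMorse.MorseModule (QuotAlg a) (matching m a) List.length i

/-- The differential `F_{i+1} → F_i`. -/
def dF (i : ℕ) : F m a (i + 1) →ₗ[QuotAlg a] F m a i :=
  AlgMorse.morseD (barD m a) (matching m a) List.length i

/-- The augmentation `F_0 → k = A/⟨x₁,…,x_n⟩`, sending the basis element `[]` to `1`. -/
def augF : F m a 0 →ₗ[QuotAlg a] (QuotAlg a ⧸ maxIdeal a) :=
  Finsupp.linearCombination (QuotAlg a) fun _ => 1

end CommAnick

end

/-!
For a matching without infinite paths the chains split into the critical cells, the span `U` of the
sources of matching edges, and `∂U`. Summing over paths is the projection onto the critical cells: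
it kills `U` and `∂U` and commutes with the differentials, so that the Morse complex inherits the
exactness of the bar resolution, which is contracted by `v[w₁|…|w_l] ↦ [v|w₁|…|w_l]`.

The matching reads a cell letter by letter. At first all letters are allowed; after an allowed
letter `x_i` the letter `x_j` is allowed if it was allowed before and `j < i`, or if `x_i x_j` is
not standard. Since the initial ideal is generated in degree two, an edge of the matching splits the
first entry that is not a letter at its least allowed letter. The steps of the graph weakly decrease
the product of all entries and, among the cells with the same product, the words formed by the least
allowed letters change monotonically, so there are no cycles. All entries of a critical cell are
letters; hence the path sums between critical cells of consecutive degrees lower the total degree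
of the entries, which forces a factor in `𝔪`.
-/

namespace AlgMorse

section Paths

variable {C R : Type*} [CommRing R] {D : C → C →₀ R} {M : C → C → Prop}

/-- An acyclic matching whose graph `G_M` has no infinite directed path, so that all sums over paths
are finite. -/
structure IsMorseMatching (D : C → C →₀ R) (M : C → C → Prop) : Prop
    extends IsAcyclicMatching D M where
  wellFounded : WellFounded (Function.swap (Step D M))

theorem IsAcyclicMatching.finite_steps (hM : IsAcyclicMatching D M) (c : C) :
    {d | Step D M c d}.Finite := by
  have hsource : {d | M d c}.Subsingleton := fun d hd d' hd' =>
    (hM.matching c d c d' c hd hd' (.inr rfl) (.inr rfl)).1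
  refine ((D c).support.finite_toSet.union hsource.finite).subset ?_
  rintro d (⟨h, -⟩ | h)
  · exact .inl (Finsupp.mem_support_iff.2 h)
  · exact .inr h

theorem IsMorseMatching.finite_paths (hM : IsMorseMatching D M) (c : C) :
    {p | IsPath D M p ∧ p.head? = some c}.Finite := by
  induction c using hM.wellFounded.induction with
  | _ c ih =>
    refine ((Set.finite_singleton [c]).union ((hM.finite_steps c).biUnion
      (t := fun d => List.cons c '' {p | IsPath D M p ∧ p.head? = some d})
      fun d hd => (ih d hd).image _)).subset ?_
    rintro p ⟨hp, hc⟩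
    match p, hp, hc with
    | [x], _, hc =>
      obtain rfl : x = c := by simpa using hc
      exact .inl rfl
    | x :: d :: p, hp, hc =>
      obtain rfl : x = c := by simpa using hc
      obtain ⟨hstep, hp⟩ := List.isChain_cons_cons.1 hp
      exact .inr (Set.mem_biUnion hstep ⟨d :: p, ⟨hp, rfl⟩, rfl⟩)

/-- The directed paths from `c` to `e` in `G_M`. -/
def pathSet (D : C → C →₀ R) (M : C → C → Prop) (c e : C) : Set (List C) :=
  {p : List C | IsPath D M p ∧ p.head? = some c ∧ p.getLast? = some e}

theorem eq_cons_of_mem_pathSet {c e : C} {p : List C} (hp : p ∈ pathSet D M c e) :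
    ∃ q, p = c :: q :=
  List.head?_eq_some_iff.1 hp.2.1

theorem singleton_mem_pathSet {c e x : C} : [x] ∈ pathSet D M c e ↔ x = c ∧ x = e := by
  simp [pathSet, IsPath]

theorem cons_cons_mem_pathSet {c d e x : C} {p : List C} :
    x :: d :: p ∈ pathSet D M c e ↔ x = c ∧ Step D M c d ∧ d :: p ∈ pathSet D M d e := by
  simp only [pathSet, IsPath, Set.mem_ofPred_eq, List.isChain_cons_cons, List.head?_cons,
    Option.some.injEq, List.getLast?_cons_cons, true_and]
  constructor
  · rintro ⟨⟨hstep, hp⟩, rfl, he⟩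
    exact ⟨rfl, hstep, hp, he⟩
  · rintro ⟨rfl, hstep, hp, he⟩
    exact ⟨⟨hstep, hp⟩, rfl, he⟩

theorem IsMorseMatching.finite_pathSet (hM : IsMorseMatching D M) (c e : C) :
    (pathSet D M c e).Finite :=
  (hM.finite_paths c).subset fun _ hp => ⟨hp.1, hp.2.1⟩

theorem pathSet_eq (c e : C) :
    pathSet D M c e = {p | p = [c] ∧ c = e} ∪
      ⋃ d ∈ {d | Step D M c d}, List.cons c '' pathSet D M d e := by
  ext p
  simp only [Set.mem_union, Set.mem_iUnion, Set.mem_ofPred_eq, Set.mem_image, exists_prop]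
  constructor
  · intro hp
    obtain ⟨q, rfl⟩ := eq_cons_of_mem_pathSet hp
    cases q with
    | nil => exact .inl ⟨rfl, (singleton_mem_pathSet.1 hp).2⟩
    | cons d q =>
      obtain ⟨-, hstep, hq⟩ := cons_cons_mem_pathSet.1 hp
      exact .inr ⟨d, hstep, _, hq, rfl⟩
  · rintro (⟨rfl, rfl⟩ | ⟨d, hstep, p, hp, rfl⟩)
    · exact singleton_mem_pathSet.2 ⟨rfl, rfl⟩
    · obtain ⟨q, rfl⟩ := eq_cons_of_mem_pathSet hp
      exact cons_cons_mem_pathSet.2 ⟨rfl, hstep, hp⟩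

theorem disjoint_cons_image_pathSet {c d d' e : C} (hne : d ≠ d') :
    Disjoint (List.cons c '' pathSet D M d e) (List.cons c '' pathSet D M d' e) := by
  refine Set.disjoint_left.2 ?_
  rintro _ ⟨p, hp, rfl⟩ ⟨p', hp', h⟩
  obtain ⟨q, rfl⟩ := eq_cons_of_mem_pathSet hp
  obtain ⟨q', rfl⟩ := eq_cons_of_mem_pathSet hp'
  simp only [List.cons.injEq, true_and] at h
  exact hne h.1.symm

theorem IsMorseMatching.finsum_cons_image_pathSet (hM : IsMorseMatching D M) (c d e : C) :
    ∑ᶠ p ∈ List.cons c '' pathSet D M d e, pathWeight D M p =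
      stepWeight D M c d * Gam D M d e := by
  rw [finsum_mem_image List.cons_injective.injOn]
  change _ = _ * ∑ᶠ p ∈ pathSet D M d e, pathWeight D M p
  rw [mul_finsum_mem' _ _ (hM.finite_pathSet d e)]
  refine finsum_mem_congr rfl fun p hp => ?_
  obtain ⟨q, rfl⟩ := eq_cons_of_mem_pathSet hp
  rfl

open Classical in
theorem IsMorseMatching.Gam_eq (hM : IsMorseMatching D M) (c e : C) :
    Gam D M c e = (if c = e then 1 else 0) +
      ∑ d ∈ (hM.finite_steps c).toFinset, stepWeight D M c d * Gam D M d e := by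
  have htriv : {p | p = [c] ∧ c = e} = if c = e then {[c]} else (∅ : Set (List C)) := by
    ext p
    split_ifs with h <;> simp [h]
  have hfin : ∀ d, (List.cons c '' pathSet D M d e).Finite :=
    fun d => (hM.finite_pathSet d e).image _
  have hdisj : Disjoint {p | p = [c] ∧ c = e}
      (⋃ d ∈ {d | Step D M c d}, List.cons c '' pathSet D M d e) := by
    simp only [Set.disjoint_iUnion_right]
    refine fun d _ => Set.disjoint_left.2 ?_
    rintro _ ⟨rfl, -⟩ ⟨p, hp, h⟩
    obtain ⟨q, rfl⟩ := eq_cons_of_mem_pathSet hp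
    simp at h
  change ∑ᶠ p ∈ pathSet D M c e, pathWeight D M p = _
  rw [pathSet_eq, finsum_mem_union hdisj ((Set.finite_singleton [c]).subset fun _ hp => hp.1)
      ((hM.finite_steps c).biUnion fun d _ => hfin d),
    finsum_mem_biUnion (fun _ _ _ _ => disjoint_cons_image_pathSet) (hM.finite_steps c)
      fun d _ => hfin d,
    finsum_mem_congr rfl fun d _ => hM.finsum_cons_image_pathSet c d e,
    finsum_mem_eq_finite_toFinset_sum _ (hM.finite_steps c), htriv]
  congr 1
  split_ifs
  · exact finsum_mem_singleton
  · exact finsum_mem_empty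

theorem IsMorseMatching.finite_Gam_ne_zero (hM : IsMorseMatching D M) (c : C) :
    {e | Gam D M c e ≠ 0}.Finite := by
  have hends : (⋃ p ∈ {p | IsPath D M p ∧ p.head? = some c}, {e | p.getLast? = some e}).Finite :=
    (hM.finite_paths c).biUnion fun p _ => Set.Subsingleton.finite fun x hx y hy =>
      Option.some_injective _ (hx.symm.trans hy)
  refine hends.subset fun e he => ?_
  obtain ⟨p, hp, -⟩ := exists_ne_zero_of_finsum_mem_ne_zero he
  exact Set.mem_biUnion (show p ∈ {p | _ ∧ _} from ⟨hp.1, hp.2.1⟩) hp.2.2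

theorem pathWeight_mem {I : Ideal R} {t : C → ℕ}
    (hI : ∀ c d, Step D M c d → t d < t c → stepWeight D M c d ∈ I) :
    ∀ (p : List C) (c e : C), p ∈ pathSet D M c e → t e < t c → pathWeight D M p ∈ I
  | [], _, _, hp, _ => by simp [pathSet] at hp
  | [x], c, e, hp, h => by
    obtain ⟨rfl, rfl⟩ := singleton_mem_pathSet.1 hp
    exact (lt_irrefl _ h).elim
  | x :: d :: p, c, e, hp, h => by
    obtain ⟨rfl, hstep, hp⟩ := cons_cons_mem_pathSet.1 hp
    by_cases hd : t d < t x
    · exact I.mul_mem_right _ (hI x d hstep hd)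
    · exact I.mul_mem_left _ (pathWeight_mem hI (d :: p) d e hp (h.trans_le (not_lt.1 hd)))

theorem Gam_mem {I : Ideal R} {t : C → ℕ}
    (hI : ∀ c d, Step D M c d → t d < t c → stepWeight D M c d ∈ I) {c e : C} (h : t e < t c) :
    Gam D M c e ∈ I :=
  finsum_mem_induction (· ∈ I) I.zero_mem (fun _ _ => I.add_mem)
    fun p hp => pathWeight_mem hI p c e hp h

end Paths

section MorseComplex

variable {C R : Type*} [CommRing R] {D : C → C →₀ R} {M : C → C → Prop} {deg : C → ℕ}

/-- The differential `D` lowers the degree of cells by one. -/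
def IsGraded (D : C → C →₀ R) (deg : C → ℕ) : Prop :=
  ∀ c d, D c d ≠ 0 → deg c = deg d + 1

theorem IsAcyclicMatching.not_target (hM : IsAcyclicMatching D M) {a b : C} (h : M a b) (c : C) :
    ¬ M c a := by
  intro h'
  obtain ⟨rfl, rfl⟩ := hM.matching a a b c a h h' (.inl rfl) (.inr rfl)
  exact hM.acyclic _ (.single (.inr h))

theorem IsAcyclicMatching.source_unique (hM : IsAcyclicMatching D M) {a a' b : C}
    (h : M a b) (h' : M a' b) : a' = a :=
  (hM.matching b a' b a b h' h (.inr rfl) (.inr rfl)).1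

theorem IsAcyclicMatching.target_unique (hM : IsAcyclicMatching D M) {a b b' : C}
    (h : M a b) (h' : M a b') : b' = b :=
  (hM.matching a a b' a b h' h (.inl rfl) (.inl rfl)).2

theorem Step.deg_cases (hM : IsAcyclicMatching D M) (hdeg : IsGraded D deg) {c d : C}
    (h : Step D M c d) : deg c = deg d + 1 ∨ (deg d = deg c + 1 ∧ M d c) := by
  rcases h with h | h
  · exact .inl (hdeg _ _ h.1)
  · exact .inr ⟨hdeg _ _ (hM.edge _ _ h), h⟩

theorem IsMorseMatching.Gam_eq_zero (hM : IsMorseMatching D M) (hdeg : IsGraded D deg) {c e : C}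
    (he : IsCritical M e) (hc : deg c < deg e ∨ deg c = deg e ∧ c ≠ e ∧ ∀ a, ¬ M a c) :
    Gam D M c e = 0 := by
  induction c using hM.wellFounded.induction with
  | _ c ih =>
    have hne : c ≠ e := by
      rintro rfl
      rcases hc with h | h
      · exact lt_irrefl _ h
      · exact h.2.1 rfl
    rw [hM.Gam_eq, if_neg hne, zero_add]
    refine Finset.sum_eq_zero fun d hd => ?_
    have hd : Step D M c d := (hM.finite_steps _).mem_toFinset.1 hd
    rw [ih d hd, mul_zero]
    rcases hd.deg_cases hM.toIsAcyclicMatching hdeg with hlt | ⟨hgt, hdc⟩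
    · left
      rcases hc with h | h <;> omega
    · rcases hc with h | h
      · rcases (show deg d ≤ deg e by omega).lt_or_eq with h' | h'
        · exact .inl h'
        · refine .inr ⟨h', ?_, hM.not_target hdc⟩
          rintro rfl
          exact (he c).1 hdc
      · exact (h.2.2 _ hdc).elim

theorem IsMorseMatching.Gam_self (hM : IsMorseMatching D M) (hdeg : IsGraded D deg) {e : C}
    (he : IsCritical M e) : Gam D M e e = 1 := by
  rw [hM.Gam_eq, if_pos rfl, add_eq_left]
  refine Finset.sum_eq_zero fun d hd => ?_
  have hd : Step D M e d := (hM.finite_steps _).mem_toFinset.1 hd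
  rcases hd.deg_cases hM.toIsAcyclicMatching hdeg with hlt | ⟨-, hde⟩
  · rw [hM.Gam_eq_zero hdeg he (.inl (by omega)), mul_zero]
  · exact ((he d).2 hde).elim

open Classical in
theorem IsMorseMatching.Gam_of_not_target (hM : IsMorseMatching D M) {c e : C} (hne : c ≠ e)
    (hc : ∀ a, ¬ M a c) :
    Gam D M c e = ∑ d ∈ (D c).support with ¬ M c d, D c d * Gam D M d e := by
  rw [hM.Gam_eq, if_neg hne, zero_add]
  refine Finset.sum_congr ?_ fun d _ => ?_
  · ext d
    simp [Step, hc d]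
  · rw [stepWeight, if_neg (hc d)]

theorem IsMorseMatching.Gam_of_isCritical (hM : IsMorseMatching D M) {c e : C} (hne : c ≠ e)
    (hc : IsCritical M c) : Gam D M c e = (D c).sum fun d r => r * Gam D M d e := by
  classical
  rw [hM.Gam_of_not_target hne fun a => (hc a).2,
    Finset.filter_true_of_mem fun d _ => (hc d).1, Finsupp.sum]

theorem IsMorseMatching.Gam_target (hM : IsMorseMatching D M) (hdeg : IsGraded D deg) {a b e : C}
    (he : IsCritical M e) (hab : M a b) (ha : deg a = deg e + 1) :
    Gam D M b e = - Ring.inverse (D a b) * Gam D M a e := by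
  have hb := hdeg a b (hM.edge a b hab)
  have hbe : b ≠ e := by
    rintro rfl
    exact (he a).2 hab
  rw [hM.Gam_eq, if_neg hbe, zero_add, Finset.sum_eq_single a, stepWeight, if_pos hab]
  · intro d hd hda
    have hd : Step D M b d := (hM.finite_steps _).mem_toFinset.1 hd
    rcases hd.deg_cases hM.toIsAcyclicMatching hdeg with hlt | ⟨-, hdb⟩
    · rw [hM.Gam_eq_zero hdeg he (.inl (by omega)), mul_zero]
    · exact (hda (hM.source_unique hab hdb)).elim
  · exact fun h => (h ((Set.Finite.mem_toFinset _).2 (.inr hab))).elim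

theorem IsMorseMatching.sum_mul_Gam_of_source (hM : IsMorseMatching D M) (hdeg : IsGraded D deg)
    {a b e : C} (he : IsCritical M e) (hab : M a b) (ha : deg a = deg e + 1) :
    ((D a).sum fun d r => r * Gam D M d e) = 0 := by
  classical
  have hae : a ≠ e := by
    rintro rfl
    exact (he b).1 hab
  have hfilter : (D a).support.filter (fun d => ¬ M a d) = (D a).support.erase b := by
    ext d
    simp only [Finset.mem_filter, Finset.mem_erase, and_comm]
    refine and_congr_left fun _ => not_congr ⟨fun h => hM.target_unique hab h, ?_⟩
    rintro rfl
    exact hab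
  have hGam := hM.Gam_of_not_target hae (hM.not_target hab)
  rw [hfilter] at hGam
  rw [Finsupp.sum, ← Finset.add_sum_erase _ _ (Finsupp.mem_support_iff.2 (hM.edge a b hab)),
    ← hGam, hM.Gam_target hdeg he hab ha, ← mul_assoc, mul_neg,
    Ring.mul_inverse_cancel _ (hM.invertible a b hab)]
  ring

/-- The differential of the based complex, defined on the sum of its modules over all degrees. -/
noncomputable def boundary (D : C → C →₀ R) : (C →₀ R) →ₗ[R] (C →₀ R) :=
  Finsupp.linearCombination R D

theorem boundary_single_one (c : C) : boundary D (Finsupp.single c 1) = D c := by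
  simp [boundary]

/-- The module of chains of degree `i`. -/
abbrev chains (R : Type*) [CommRing R] {C : Type*} (deg : C → ℕ) (i : ℕ) : Submodule R (C →₀ R) :=
  Finsupp.supported R R {c | deg c = i}

/-- The span of the sources of matching edges among the cells of degree `i`. -/
abbrev sources (R : Type*) [CommRing R] {C : Type*} (M : C → C → Prop) (deg : C → ℕ) (i : ℕ) :
    Submodule R (C →₀ R) :=
  Finsupp.supported R R {c | deg c = i ∧ ∃ b, M c b}

/-- The inclusion of the graded module underlying the Morse complex; it is not a chain map. -/
noncomputable def morseIncl (R : Type*) [CommRing R] {C : Type*} (M : C → C → Prop) (deg : C → ℕ)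
    (i : ℕ) : MorseModule R M deg i →ₗ[R] (C →₀ R) :=
  Finsupp.lmapDomain R R Subtype.val

/-- The projection `c ↦ ∑ Γ(c, e) e` of the based complex onto its Morse complex. -/
noncomputable def morseProj (D : C → C →₀ R) (M : C → C → Prop) (deg : C → ℕ) (i : ℕ) :
    (C →₀ R) →ₗ[R] MorseModule R M deg i :=
  Finsupp.linearCombination R fun c : C =>
    ∑ᶠ e : CriticalCell M deg i, Finsupp.single e (Gam D M c e.1)

theorem supported_le_iff {s : Set C} {T : Submodule R (C →₀ R)} :
    Finsupp.supported R R s ≤ T ↔ ∀ c ∈ s, Finsupp.single c 1 ∈ T := by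
  rw [Finsupp.supported_eq_span_single, Submodule.span_le, Set.image_subset_iff]
  rfl

theorem sources_le_chains (i : ℕ) : sources R M deg i ≤ chains R deg i :=
  Finsupp.supported_mono fun _ h => h.1

theorem IsGraded.boundary_mem_chains (hdeg : IsGraded D deg) {i : ℕ} {x : C →₀ R}
    (hx : x ∈ chains R deg (i + 1)) : boundary D x ∈ chains R deg i := by
  suffices h : chains R deg (i + 1) ≤ (chains R deg i).comap (boundary D) from h hx
  refine supported_le_iff.2 fun c hc => ?_
  rw [Submodule.mem_comap, boundary_single_one]
  intro d hd
  exact Nat.succ_injective ((hdeg c d (Finsupp.mem_support_iff.1 hd)).symm.trans hc)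

theorem morseIncl_single (i : ℕ) (e : CriticalCell M deg i) (r : R) :
    morseIncl R M deg i (Finsupp.single e r) = Finsupp.single e.1 r :=
  Finsupp.mapDomain_single

theorem morseIncl_mem_chains (i : ℕ) (z : MorseModule R M deg i) :
    morseIncl R M deg i z ∈ chains R deg i := by
  induction z using Finsupp.induction_linear with
  | zero => simp
  | add x y hx hy => simpa only [map_add] using add_mem hx hy
  | single c r =>
    rw [morseIncl_single]
    exact Finsupp.single_mem_supported R r c.2.2

theorem finsum_single_apply {E : Type*} {g : E → R} (hg : g.support.Finite) (e : E) :
    (∑ᶠ e', Finsupp.single e' (g e')) e = g e := by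
  classical
  rw [finsum_eq_sum_of_support_subset (s := hg.toFinset), Finset.sum_apply']
  · by_cases h : g e = 0 <;> simp [Finsupp.single_apply, h]
  · intro x hx
    simpa using hx

theorem IsMorseMatching.morseProj_apply (hM : IsMorseMatching D M) (i : ℕ) (x : C →₀ R)
    (e : CriticalCell M deg i) : morseProj D M deg i x e = x.sum fun c r => r * Gam D M c e.1 := by
  rw [morseProj, Finsupp.linearCombination_apply, Finsupp.sum_apply]
  refine Finset.sum_congr rfl fun c _ => ?_
  simp only [Finsupp.smul_apply, smul_eq_mul]
  rw [finsum_single_apply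
    (g := fun e : CriticalCell M deg i => Gam D M c e.1)
    ((hM.finite_Gam_ne_zero c).preimage Subtype.val_injective.injOn)]

theorem IsMorseMatching.morseProj_single_one_apply (hM : IsMorseMatching D M) (i : ℕ) (c : C)
    (e : CriticalCell M deg i) : morseProj D M deg i (Finsupp.single c 1) e = Gam D M c e.1 := by
  rw [hM.morseProj_apply, Finsupp.sum_single_index (zero_mul _), one_mul]

theorem morseD_eq_morseProj_comp_morseIncl (i : ℕ) :
    morseD D M deg i = morseProj D M deg i ∘ₗ morseIncl R M deg (i + 1) := by
  refine Finsupp.lhom_ext fun c r => ?_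
  simp only [morseD, morseProj, LinearMap.comp_apply, morseIncl_single,
    Finsupp.linearCombination_single]

theorem IsMorseMatching.morseD_apply (hM : IsMorseMatching D M) (i : ℕ)
    (z : MorseModule R M deg (i + 1)) :
    morseD D M deg i z = morseProj D M deg i (boundary D (morseIncl R M deg (i + 1) z)) := by
  suffices h : morseD D M deg i =
      morseProj D M deg i ∘ₗ boundary D ∘ₗ morseIncl R M deg (i + 1) from LinearMap.congr_fun h z
  refine Finsupp.lhom_ext' fun c => LinearMap.ext_ring (Finsupp.ext fun e => ?_)
  have hne : c.1 ≠ e.1 := fun h => by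
    have := c.2.2.symm.trans ((congrArg deg h).trans e.2.2)
    omega
  simp only [morseD_eq_morseProj_comp_morseIncl, LinearMap.comp_apply, Finsupp.lsingle_apply,
    morseIncl_single, boundary_single_one]
  rw [hM.morseProj_single_one_apply, hM.morseProj_apply, hM.Gam_of_isCritical hne c.2.1]

theorem IsMorseMatching.morseProj_morseIncl (hM : IsMorseMatching D M) (hdeg : IsGraded D deg)
    (i : ℕ) (z : MorseModule R M deg i) :
    morseProj D M deg i (morseIncl R M deg i z) = z := by
  classical
  suffices h : morseProj D M deg i ∘ₗ morseIncl R M deg i = LinearMap.id from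
    LinearMap.congr_fun h z
  refine Finsupp.lhom_ext' fun c => LinearMap.ext_ring (Finsupp.ext fun e => ?_)
  simp only [LinearMap.comp_apply, Finsupp.lsingle_apply, morseIncl_single, LinearMap.id_apply]
  rw [hM.morseProj_single_one_apply]
  rcases eq_or_ne c e with rfl | hne
  · rw [hM.Gam_self hdeg c.2.1, Finsupp.single_eq_same]
  · rw [Finsupp.single_eq_of_ne hne.symm, hM.Gam_eq_zero hdeg e.2.1]
    exact .inr ⟨c.2.2.trans e.2.2.symm, Subtype.coe_ne_coe.2 hne, fun a => (c.2.1 a).2⟩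

theorem IsMorseMatching.morseProj_eq_zero_of_mem_sources (hM : IsMorseMatching D M)
    (hdeg : IsGraded D deg) {i : ℕ} {x : C →₀ R} (hx : x ∈ sources R M deg i) :
    morseProj D M deg i x = 0 := by
  suffices h : sources R M deg i ≤ LinearMap.ker (morseProj D M deg i) from h hx
  refine supported_le_iff.2 ?_
  rintro c ⟨hc, b, hb⟩
  ext e
  rw [hM.morseProj_single_one_apply, hM.Gam_eq_zero hdeg e.2.1, Finsupp.zero_apply]
  refine .inr ⟨hc.trans e.2.2.symm, ?_, hM.not_target hb⟩
  rintro rfl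
  exact (e.2.1 b).1 hb

theorem IsMorseMatching.morseProj_boundary_eq_zero_of_mem_sources (hM : IsMorseMatching D M)
    (hdeg : IsGraded D deg) {i : ℕ} {x : C →₀ R} (hx : x ∈ sources R M deg (i + 1)) :
    morseProj D M deg i (boundary D x) = 0 := by
  suffices h : sources R M deg (i + 1) ≤ LinearMap.ker (morseProj D M deg i ∘ₗ boundary D) from
    h hx
  refine supported_le_iff.2 ?_
  rintro c ⟨hc, b, hb⟩
  ext e
  rw [LinearMap.comp_apply, boundary_single_one, hM.morseProj_apply,
    hM.sum_mul_Gam_of_source hdeg e.2.1 hb (hc.trans (congrArg (· + 1) e.2.2.symm)),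
    Finsupp.zero_apply]

theorem IsMorseMatching.single_mem_of_target (hM : IsMorseMatching D M) {T : Submodule R (C →₀ R)}
    {a c : C} (hac : M a c) (ha : D a ∈ T)
    (hT : ∀ d, D a d ≠ 0 → d ≠ c → Finsupp.single d 1 ∈ T) : Finsupp.single c 1 ∈ T := by
  classical
  have herase : (D a).erase c ∈ T := by
    refine (supported_le_iff (s := {d | D a d ≠ 0 ∧ d ≠ c})).2
      (fun d hd => hT d hd.1 hd.2) fun d hd => ?_
    rw [Finset.mem_coe, Finsupp.support_erase, Finset.mem_erase, Finsupp.mem_support_iff] at hd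
    exact hd.symm
  have hsingle : Finsupp.single c (D a c) ∈ T := by
    rwa [← Finsupp.single_add_erase c (D a), T.add_mem_iff_left herase] at ha
  have := T.smul_mem (Ring.inverse (D a c)) hsingle
  rwa [Finsupp.smul_single, smul_eq_mul,
    Ring.inverse_mul_cancel _ (hM.invertible a c hac)] at this

theorem IsMorseMatching.chains_le (hM : IsMorseMatching D M) (hdeg : IsGraded D deg) {i : ℕ}
    {T : Submodule R (C →₀ R)} (hcrit : LinearMap.range (morseIncl R M deg i) ≤ T)
    (hsource : sources R M deg i ≤ T) (hboundary : (sources R M deg (i + 1)).map (boundary D) ≤ T) :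
    chains R deg i ≤ T := by
  refine supported_le_iff.2 fun c => ?_
  induction c using hM.wellFounded.transGen.induction with
  | _ c ih =>
    intro hc
    by_cases htarget : ∃ a, M a c
    · obtain ⟨a, hac⟩ := htarget
      have hdega := hdeg a c (hM.edge a c hac)
      refine hM.single_mem_of_target hac ?_ fun d hd hdc => ih d ?_ ?_
      · rw [← boundary_single_one (D := D) a]
        exact hboundary (Submodule.mem_map_of_mem (Finsupp.single_mem_supported R _
          ⟨hdega.trans (congrArg (· + 1) hc), c, hac⟩))
      · have hca : Step D M c a := .inr hac
        have had : Step D M a d := .inl ⟨hd, fun h => hdc (hM.target_unique hac h)⟩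
        exact .tail (b := a) (.single had) hca
      · exact Nat.succ_injective ((hdeg a d hd).symm.trans (hdega.trans (congrArg (· + 1) hc)))
    · by_cases hsrc : ∃ b, M c b
      · exact hsource (Finsupp.single_mem_supported R _ ⟨hc, hsrc⟩)
      · refine hcrit ⟨Finsupp.single ⟨c, fun b => ⟨fun h => hsrc ⟨b, h⟩, fun h => ?_⟩, hc⟩ 1,
          morseIncl_single i _ 1⟩
        exact htarget ⟨b, h⟩

theorem IsMorseMatching.morseProj_boundary (hM : IsMorseMatching D M) (hdeg : IsGraded D deg)
    (hDD : boundary D ∘ₗ boundary D = 0) {i : ℕ} {x : C →₀ R} (hx : x ∈ chains R deg (i + 1)) :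
    morseProj D M deg i (boundary D x) = morseD D M deg i (morseProj D M deg (i + 1) x) := by
  suffices h : chains R deg (i + 1) ≤ LinearMap.eqLocus (morseProj D M deg i ∘ₗ boundary D)
      (morseD D M deg i ∘ₗ morseProj D M deg (i + 1)) from h hx
  refine hM.chains_le hdeg ?_ ?_ ?_
  · rintro _ ⟨z, rfl⟩
    simp only [LinearMap.mem_eqLocus, LinearMap.comp_apply]
    rw [hM.morseProj_morseIncl hdeg, hM.morseD_apply]
  · intro s hs
    simp only [LinearMap.mem_eqLocus, LinearMap.comp_apply]
    rw [hM.morseProj_boundary_eq_zero_of_mem_sources hdeg hs,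
      hM.morseProj_eq_zero_of_mem_sources hdeg hs, map_zero]
  · rintro _ ⟨s, hs, rfl⟩
    have hss : boundary D (boundary D s) = 0 := LinearMap.congr_fun hDD s
    simp only [LinearMap.mem_eqLocus, LinearMap.comp_apply]
    rw [hss, hM.morseProj_boundary_eq_zero_of_mem_sources hdeg hs, map_zero, map_zero]

theorem IsMorseMatching.sub_morseProj_mem (hM : IsMorseMatching D M) (hdeg : IsGraded D deg)
    {i : ℕ} {x : C →₀ R} (hx : x ∈ chains R deg i) :
    x - morseIncl R M deg i (morseProj D M deg i x) ∈
      sources R M deg i ⊔ (sources R M deg (i + 1)).map (boundary D) := by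
  suffices h : chains R deg i ≤
      (sources R M deg i ⊔ (sources R M deg (i + 1)).map (boundary D)).comap
        (LinearMap.id - morseIncl R M deg i ∘ₗ morseProj D M deg i) from h hx
  refine hM.chains_le hdeg ?_ ?_ ?_
  · rintro _ ⟨z, rfl⟩
    simp only [Submodule.mem_comap, LinearMap.sub_apply, LinearMap.id_apply, LinearMap.comp_apply]
    rw [hM.morseProj_morseIncl hdeg, sub_self]
    exact zero_mem _
  · intro s hs
    simp only [Submodule.mem_comap, LinearMap.sub_apply, LinearMap.id_apply, LinearMap.comp_apply]
    rw [hM.morseProj_eq_zero_of_mem_sources hdeg hs, map_zero, sub_zero]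
    exact Submodule.mem_sup_left hs
  · rintro _ ⟨s, hs, rfl⟩
    simp only [Submodule.mem_comap, LinearMap.sub_apply, LinearMap.id_apply, LinearMap.comp_apply]
    rw [hM.morseProj_boundary_eq_zero_of_mem_sources hdeg hs, map_zero, sub_zero]
    exact Submodule.mem_sup_right (Submodule.mem_map_of_mem hs)

theorem IsAcyclicMatching.eq_zero_of_mem_sources (hM : IsAcyclicMatching D M) {i : ℕ} {x : C →₀ R}
    (hx : x ∈ sources R M deg i) (h0 : boundary D x = 0) : x = 0 := by
  by_contra hne
  have : IsStrictOrder C (Relation.TransGen (Step D M)) :=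
    { irrefl := hM.acyclic, trans := fun _ _ _ => Relation.TransGen.trans }
  -- If no path leads from another cell of `x` to the cell `a`, then only `a` contributes to the
  -- coefficient in `∂x` of the target matched with `a`.
  obtain ⟨⟨a, ha⟩, -, hmin⟩ := (x.support.finite_toSet.wellFoundedOn
    (r := Relation.TransGen (Step D M))).has_min Set.univ
    (have ⟨a, ha⟩ := Finsupp.support_nonempty_iff.2 hne; ⟨⟨a, ha⟩, trivial⟩)
  obtain ⟨-, b, hab⟩ := hx ha
  have hcoeff : boundary D x b = x a * D a b := by
    rw [boundary, Finsupp.linearCombination_apply, Finsupp.sum_apply, Finsupp.sum,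
      Finset.sum_eq_single a (fun a' ha' hne' => ?_) fun h => (h ha).elim]
    · rw [Finsupp.smul_apply, smul_eq_mul]
    · have hzero : D a' b = 0 := by
        by_contra hD
        have ha'b : Step D M a' b := .inl ⟨hD, fun h => hne' (hM.source_unique hab h)⟩
        have hba : Step D M b a := .inr hab
        exact hmin ⟨a', ha'⟩ trivial (.tail (b := b) (.single ha'b) hba)
      rw [Finsupp.smul_apply, hzero, smul_zero]
  rw [h0, Finsupp.zero_apply, eq_comm, (hM.invertible a b hab).mul_left_eq_zero] at hcoeff
  exact Finsupp.mem_support_iff.1 ha hcoeff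

theorem IsMorseMatching.exists_lift_cycle (hM : IsMorseMatching D M) (hdeg : IsGraded D deg)
    (hDD : boundary D ∘ₗ boundary D = 0) {i : ℕ} {z : MorseModule R M deg (i + 1)}
    (hz : morseD D M deg i z = 0) :
    ∃ x ∈ chains R deg (i + 1), boundary D x = 0 ∧ morseProj D M deg (i + 1) x = z := by
  have hDD' : ∀ x, boundary D (boundary D x) = 0 := LinearMap.congr_fun hDD
  have hmem := hM.sub_morseProj_mem hdeg (hdeg.boundary_mem_chains (morseIncl_mem_chains (i + 1) z))
  rw [← hM.morseD_apply, hz, map_zero, sub_zero] at hmem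
  obtain ⟨s, hs, _, ⟨s', hs', rfl⟩, hsum⟩ := Submodule.mem_sup.1 hmem
  have hs0 : boundary D s = 0 := by
    simpa only [map_add, hDD', add_zero] using congrArg (boundary D) hsum
  obtain rfl := hM.eq_zero_of_mem_sources hs hs0
  refine ⟨morseIncl R M deg (i + 1) z - s',
    sub_mem (morseIncl_mem_chains _ _) (sources_le_chains _ hs'), ?_, ?_⟩
  · rw [map_sub, ← hsum, zero_add, sub_self]
  · rw [map_sub, hM.morseProj_morseIncl hdeg, hM.morseProj_eq_zero_of_mem_sources hdeg hs',
      sub_zero]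

theorem IsMorseMatching.exact_morseD (hM : IsMorseMatching D M) (hdeg : IsGraded D deg)
    (hDD : boundary D ∘ₗ boundary D = 0) (i : ℕ)
    (hex : ∀ x ∈ chains R deg (i + 1), boundary D x = 0 →
      x ∈ (chains R deg (i + 2)).map (boundary D)) :
    Function.Exact (morseD D M deg (i + 1)) (morseD D M deg i) := by
  intro z
  constructor
  · intro hz
    obtain ⟨x, hx, hx0, rfl⟩ := hM.exists_lift_cycle hdeg hDD hz
    obtain ⟨y, hy, rfl⟩ := hex x hx hx0
    exact ⟨_, (hM.morseProj_boundary hdeg hDD hy).symm⟩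
  · rintro ⟨y, rfl⟩
    have hzero := LinearMap.congr_fun hDD (morseIncl R M deg (i + 1 + 1) y)
    rw [LinearMap.comp_apply, LinearMap.zero_apply] at hzero
    rw [hM.morseD_apply (i + 1), ← hM.morseProj_boundary hdeg hDD
      (hdeg.boundary_mem_chains (morseIncl_mem_chains _ _)), hzero, map_zero]

theorem IsMorseMatching.exact_morseD_augmentation (hM : IsMorseMatching D M)
    (hdeg : IsGraded D deg) (hDD : boundary D ∘ₗ boundary D = 0) {N : Type*} [AddCommGroup N]
    [Module R N] (ε : (C →₀ R) →ₗ[R] N)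
    (hε : ∀ x ∈ chains R deg 0, ε x = 0 ↔ x ∈ (chains R deg 1).map (boundary D)) :
    Function.Exact (morseD D M deg 0) (ε ∘ₗ morseIncl R M deg 0) := by
  have hsources : sources R M deg 0 = ⊥ := by
    refine eq_bot_iff.2 (supported_le_iff.2 ?_)
    rintro c ⟨hc, b, hb⟩
    exact (Nat.succ_ne_zero _ ((hdeg c b (hM.edge c b hb)).symm.trans hc)).elim
  intro z
  rw [LinearMap.comp_apply, hε _ (morseIncl_mem_chains 0 z)]
  constructor
  · rintro ⟨y, hy, hyz⟩
    exact ⟨morseProj D M deg 1 y, by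
      rw [← hM.morseProj_boundary hdeg hDD hy, hyz, hM.morseProj_morseIncl hdeg]⟩
  · rintro ⟨y, rfl⟩
    set x := morseIncl R M deg 1 y with hx
    have hxmem : x ∈ chains R deg 1 := morseIncl_mem_chains 1 y
    have hmem := hM.sub_morseProj_mem hdeg (hdeg.boundary_mem_chains hxmem)
    rw [hsources, bot_sup_eq] at hmem
    rw [hM.morseD_apply, ← hx, ← sub_sub_cancel (boundary D x) (morseIncl R M deg 0 _)]
    exact sub_mem (Submodule.mem_map_of_mem hxmem)
      (Submodule.map_mono (sources_le_chains 1) hmem)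

theorem range_morseD_le {I : Ideal R} {i : ℕ}
    (hI : ∀ (c : CriticalCell M deg (i + 1)) (e : CriticalCell M deg i), Gam D M c.1 e.1 ∈ I) :
    LinearMap.range (morseD D M deg i) ≤ I • (⊤ : Submodule R (MorseModule R M deg i)) := by
  rw [morseD, Finsupp.range_linearCombination, Submodule.span_le]
  rintro _ ⟨c, rfl⟩
  rw [SetLike.mem_coe]
  refine finsum_induction (· ∈ I • (⊤ : Submodule R (MorseModule R M deg i))) (zero_mem _)
    (fun _ _ => add_mem) fun e => ?_
  rw [← mul_one (Gam D M c.1 e.1), ← smul_eq_mul, ← Finsupp.smul_single]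
  exact Submodule.smul_mem_smul (hI c e) trivial

end MorseComplex

end AlgMorse

namespace CommAnick

open MvPolynomial (monomial)

variable {k : Type*} [Field k] {n : ℕ}

attribute [local instance] MvPolynomial.gradedAlgebra

/-! ## Initial ideals generated in degree two -/

section Groebner

open MvPolynomial

variable {m : MonomialOrder (Fin n)} {a : Ideal (MvPolynomial (Fin n) k)}
  {B : Set (MvPolynomial (Fin n) k)} {u v w : Fin n →₀ ℕ}

variable (m a) in
theorem sub_normalForm_mem (f : MvPolynomial (Fin n) k) : f - normalForm m a f ∈ a :=
  (exists_normalForm m a f).choose_spec.1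

theorem IsStandard.of_mem_support_normalForm {f : MvPolynomial (Fin n) k}
    (hv : v ∈ (normalForm m a f).support) : IsStandard m a v :=
  (exists_normalForm m a f).choose_spec.2 v hv

theorem IsStandard.mono (hv : IsStandard m a v) (h : u ≤ v) : IsStandard m a u := by
  classical
  intro f hf hf0 hd
  have hm : monomial (v - u) (1 : k) ≠ 0 := by simp
  refine hv (f * monomial (v - u) 1) (a.mul_mem_right _ hf) (mul_ne_zero hf0 hm) ?_
  rw [m.degree_mul hf0 hm, m.degree_monomial, if_neg one_ne_zero, hd, add_tsub_cancel_of_le h]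

theorem normalForm_monomial (hv : IsStandard m a v) :
    normalForm m a (monomial v 1) = monomial v 1 := by
  refine (eq_normalForm m a _ _ (by simp) fun u hu => ?_).symm
  rwa [Finset.mem_singleton.1 (support_monomial_subset hu)]

theorem degree_monomial_sub_normalForm (hv : ¬ IsStandard m a v) :
    m.degree (monomial v 1 - normalForm m a (monomial v 1)) = v := by
  classical
  have hcoeff : (normalForm m a (monomial v 1)).coeff v = 0 :=
    notMem_support_iff.1 fun h => hv (.of_mem_support_normalForm h)
  have hne : monomial v 1 - normalForm m a (monomial v 1) ≠ 0 := fun h => by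
    simpa [hcoeff] using congrArg (coeff v) h
  rcases Finset.mem_union.1 (support_sub _ _ _ (m.degree_mem_support hne)) with h | h
  · exact Finset.mem_singleton.1 (support_monomial_subset h)
  · exact (IsStandard.of_mem_support_normalForm h _ (sub_normalForm_mem m a _) hne rfl).elim

theorem eq_or_lt_of_mem_support_normalForm
    (h : v ∈ (normalForm m a (monomial u 1)).support) : v = u ∨ v ≺[m] u := by
  classical
  by_cases hu : IsStandard m a u
  · rw [normalForm_monomial hu] at h
    exact .inl (Finset.mem_singleton.1 (support_monomial_subset h))
  · have hvu : v ≠ u := fun hvu => hu (hvu ▸ .of_mem_support_normalForm h)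
    have hmem : v ∈ (monomial u 1 - normalForm m a (monomial u 1)).support := by
      simpa [coeff_monomial, hvu.symm] using h
    have hle := m.le_degree hmem
    rw [degree_monomial_sub_normalForm hu] at hle
    exact .inr (hle.lt_of_ne (m.toSyn.injective.ne hvu))

theorem degree_eq_of_mem_support_normalForm
    (ha : a.IsHomogeneous (homogeneousSubmodule (Fin n) k))
    (h : v ∈ (normalForm m a (monomial u 1)).support) : v.degree = u.degree := by
  have hmem := homogeneousComponent_mem_of_mem ha (sub_normalForm_mem m a (monomial u 1)) u.degree
  rw [map_sub, homogeneousComponent_eq_self (isHomogeneous_monomial _ rfl)] at hmem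
  have hcomp := eq_normalForm m a _ _ hmem fun w hw => by
    rw [support_homogeneousComponent, Finset.mem_filter] at hw
    exact .of_mem_support_normalForm hw.1
  rw [← hcomp, support_homogeneousComponent, Finset.mem_filter] at h
  exact h.2

theorem le_ker_constantCoeff (ha : a.IsHomogeneous (homogeneousSubmodule (Fin n) k))
    [Nontrivial (QuotAlg a)] : a ≤ RingHom.ker (constantCoeff (R := k) (σ := Fin n)) := by
  intro f hf
  have hmem := homogeneousComponent_mem_of_mem ha hf 0
  rw [homogeneousComponent_zero] at hmem
  by_contra hf0
  exact Ideal.Quotient.nontrivial_iff.1 inferInstance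
    (a.eq_top_of_isUnit_mem hmem ((isUnit_iff_ne_zero.2 hf0).map C))

theorem isCompl_restrictSupport_isStandard (m : MonomialOrder (Fin n))
    (a : Ideal (MvPolynomial (Fin n) k)) :
    IsCompl (a.restrictScalars k) (restrictSupport k {v | IsStandard m a v}) := by
  refine ⟨Submodule.disjoint_def.2 fun f hf hstd => ?_, codisjoint_iff_le_sup.2 fun f _ => ?_⟩
  · by_contra hf0
    exact hstd (m.degree_mem_support hf0) f hf hf0 rfl
  · rw [← sub_add_cancel f (normalForm m a f)]
    exact Submodule.add_mem_sup (sub_normalForm_mem m a f) fun v => .of_mem_support_normalForm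

/-- Macaulay's basis theorem: the residue classes of the standard monomials form a basis of `A`. -/
noncomputable def standardBasis (m : MonomialOrder (Fin n)) (a : Ideal (MvPolynomial (Fin n) k)) :
    Module.Basis {v | IsStandard m a v} k (QuotAlg a) :=
  (basisRestrictSupport k {v | IsStandard m a v}).map
    ((Submodule.quotientEquivOfIsCompl _ _ (isCompl_restrictSupport_isStandard m a)).symm ≪≫ₗ
      Submodule.Quotient.restrictScalarsEquiv k a)

theorem coe_basisRestrictSupport_apply {σ R : Type*} [CommSemiring R] {s : Set (σ →₀ ℕ)} (v : s) :
    (basisRestrictSupport R s v : MvPolynomial σ R) = monomial v.1 1 :=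
  congrArg AddMonoidAlgebra.ofCoeff (Finsupp.supportedEquivFinsupp_symm_single s v (1 : R))

theorem standardBasis_apply (v : {v | IsStandard m a v}) :
    standardBasis m a v = Ideal.Quotient.mk a (monomial v.1 1) := by
  rw [← coe_basisRestrictSupport_apply]
  rfl

theorem not_isStandard_iff (hB : IsGroebnerBasis m B a) :
    ¬ IsStandard m a v ↔ ∃ b ∈ B, b ≠ 0 ∧ m.degree b ≤ v := by
  refine ⟨fun h => ?_, fun ⟨b, hb, hb0, hle⟩ hv => hv.mono hle b (hB.1 hb) hb0 rfl⟩
  simp only [IsStandard, not_forall, not_not] at h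
  obtain ⟨f, hf, hf0, rfl⟩ := h
  have hlead : m.leadingTerm f ∈ Ideal.span (m.leadingTerm '' B) := by
    rw [hB.2]
    exact Ideal.subset_span ⟨f, hf, rfl⟩
  rw [m.span_leadingTerm_eq_span_monomial', ← Set.image_image (fun s => monomial s 1),
    mem_ideal_span_monomial_image] at hlead
  obtain ⟨_, ⟨b, ⟨hb, hb0⟩, rfl⟩, hle⟩ := hlead (m.degree f) (by simp [m.support_leadingTerm' hf0])
  exact ⟨b, hb, hb0, hle⟩

theorem IsGroebnerBasis.span_eq (hB : IsGroebnerBasis m B a) : Ideal.span B = a := by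
  refine le_antisymm (Ideal.span_le.2 hB.1) fun f hf => ?_
  obtain ⟨g, r, hfr, -, hr⟩ := MonomialOrder.div_set (m := m) (B := {b | b ∈ B ∧ b ≠ 0})
    (fun b hb => (MonomialOrder.leadingCoeff_ne_zero_iff.2 hb.2).isUnit) f
  have hg : Finsupp.linearCombination _ (fun b : {b | b ∈ B ∧ b ≠ 0} => b.1) g ∈
      Ideal.span B := by
    rw [Finsupp.linearCombination_apply]
    exact Submodule.sum_mem _ fun b _ => Ideal.mul_mem_left _ _ (Ideal.subset_span b.2.1)
  have hr0 : r = 0 := by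
    by_contra h0
    have hra : r ∈ a := by
      have := a.sub_mem hf (Ideal.span_le.2 hB.1 hg)
      rwa [hfr, add_sub_cancel_left] at this
    obtain ⟨b, hb, hb0, hle⟩ := (not_isStandard_iff hB).1 fun h : IsStandard m a _ =>
      h r hra h0 rfl
    exact hr _ (m.degree_mem_support h0) b ⟨hb, hb0⟩ hle
  rwa [hfr, hr0, add_zero]

theorem IsGroebnerBasis.isHomogeneous (hB : IsGroebnerBasis m B a)
    (h : ∀ b ∈ B, ∃ d, b.IsHomogeneous d) : a.IsHomogeneous (homogeneousSubmodule (Fin n) k) := by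
  rw [← hB.span_eq]
  exact Ideal.homogeneous_span _ _ h

/-- The initial ideal of `a` is generated in degree two: every nonstandard monomial is divisible by
a nonstandard one of degree two. -/
def HasQuadraticInitialIdeal (m : MonomialOrder (Fin n)) (a : Ideal (MvPolynomial (Fin n) k)) :
    Prop :=
  ∀ v, ¬ IsStandard m a v → ∃ u ≤ v, u.degree = 2 ∧ ¬ IsStandard m a u

theorem IsGroebnerBasis.hasQuadraticInitialIdeal (hB : IsGroebnerBasis m B a)
    (hquad : ∀ b ∈ B, b.IsHomogeneous 2) : HasQuadraticInitialIdeal m a := by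
  intro v hv
  obtain ⟨b, hb, hb0, hle⟩ := (not_isStandard_iff hB).1 hv
  refine ⟨m.degree b, hle, ?_, fun h => h b (hB.1 hb) hb0 rfl⟩
  by_contra hne
  exact mem_support_iff.1 (m.degree_mem_support hb0) ((hquad b hb).coeff_eq_zero hne)

namespace HasQuadraticInitialIdeal

theorem isStandard_of_degree_le_one (ha : HasQuadraticInitialIdeal m a) (hv : v.degree ≤ 1) :
    IsStandard m a v := by
  by_contra h
  obtain ⟨u, hle, hu, -⟩ := ha v h
  have := Finsupp.degree_mono hle
  omega

theorem nontrivial_quotAlg (ha : HasQuadraticInitialIdeal m a) : Nontrivial (QuotAlg a) := by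
  rw [Ideal.Quotient.nontrivial_iff, Ne, Ideal.eq_top_iff_one]
  exact fun h => ha.isStandard_of_degree_le_one (v := 0) (by simp) 1 h one_ne_zero m.degree_one

end HasQuadraticInitialIdeal

theorem eq_single_of_degree_eq_one (h : u.degree = 1) : ∃ i, u = Finsupp.single i 1 := by
  obtain ⟨i, hi⟩ := Finsupp.ne_iff.1 fun h0 : u = 0 => by simp [h0] at h
  have hle : Finsupp.single i 1 ≤ u := by
    rw [Finsupp.single_le_iff]
    exact Nat.one_le_iff_ne_zero.2 hi
  have hsum := add_tsub_cancel_of_le hle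
  have hrest : u - Finsupp.single i 1 = 0 := by
    have := congrArg Finsupp.degree hsum
    rw [map_add, Finsupp.degree_single, h] at this
    rw [← Finsupp.degree_eq_zero_iff]
    omega
  exact ⟨i, by rw [← hsum, hrest, add_zero]⟩

theorem HasQuadraticInitialIdeal.exists_of_not_isStandard_add (ha : HasQuadraticInitialIdeal m a)
    (hv : IsStandard m a v) (hw : IsStandard m a w) (hvw : ¬ IsStandard m a (v + w)) :
    ∃ i j, v i ≠ 0 ∧ w j ≠ 0 ∧
      ¬ IsStandard m a (Finsupp.single i 1 + Finsupp.single j 1) := by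
  obtain ⟨u, hle, hdeg, hu⟩ := ha _ hvw
  have hsum : u ⊓ v + (u - v) = u := by
    ext i
    simp only [Finsupp.coe_add, Pi.add_apply, Finsupp.inf_apply, Finsupp.coe_tsub, Pi.sub_apply]
    omega
  have huw : u - v ≤ w := tsub_le_iff_left.2 hle
  have h1 : (u ⊓ v).degree ≠ 0 := fun h0 => hu <| hw.mono <| by
    rw [(Finsupp.degree_eq_zero_iff _).1 h0, zero_add] at hsum
    rwa [hsum] at huw
  have h2 : (u - v).degree ≠ 0 := fun h0 =>
    hu (hv.mono (tsub_eq_zero_iff_le.1 ((Finsupp.degree_eq_zero_iff _).1 h0)))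
  have h3 := congrArg Finsupp.degree hsum
  rw [map_add, hdeg] at h3
  obtain ⟨i, hi⟩ := eq_single_of_degree_eq_one (u := u ⊓ v) (by omega)
  obtain ⟨j, hj⟩ := eq_single_of_degree_eq_one (u := u - v) (by omega)
  refine ⟨i, j, ?_, ?_, by rwa [← hi, ← hj, hsum]⟩
  · have hiv : u ⊓ v ≤ v := inf_le_right
    rwa [hi, Finsupp.single_le_iff, Nat.one_le_iff_ne_zero] at hiv
  · rwa [hj, Finsupp.single_le_iff, Nat.one_le_iff_ne_zero] at huw

end Groebner

/-! ## The contracting homotopy of the bar resolution -/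

section Merging

/-- The second list arises from the first one by replacing two neighbours `u`, `v` by an entry `w`
with `r u v w`. -/
inductive ListMerge {α : Type*} (r : α → α → α → Prop) : List α → List α → Prop
  | head {u v w : α} {q : List α} (h : r u v w) : ListMerge r (u :: v :: q) (w :: q)
  | cons {u : α} {c d : List α} (h : ListMerge r c d) : ListMerge r (u :: c) (u :: d)

theorem ListMerge.length_eq {α : Type*} {r : α → α → α → Prop} {c d : List α}
    (h : ListMerge r c d) : c.length = d.length + 1 := by
  induction h with
  | head => rfl
  | cons _ ih => simp [ih]

theorem ListMerge.append_left {α : Type*} {r : α → α → α → Prop} {u v w : α} (h : r u v w)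
    (p q : List α) : ListMerge r (p ++ u :: v :: q) (p ++ w :: q) := by
  induction p with
  | nil => exact .head h
  | cons _ _ ih => exact .cons ih

end Merging

section Bar

variable {m : MonomialOrder (Fin n)} {a : Ideal (MvPolynomial (Fin n) k)}

theorem mk_eq_sum_normalForm (f : MvPolynomial (Fin n) k) :
    Ideal.Quotient.mk a f = ∑ v ∈ (normalForm m a f).support,
      (normalForm m a f).coeff v • Ideal.Quotient.mk a (monomial v 1) := by
  rw [Ideal.Quotient.eq.2 (sub_normalForm_mem m a f)]
  conv_lhs => rw [(normalForm m a f).as_sum, map_sum]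
  refine Finset.sum_congr rfl fun v _ => ?_
  rw [← Ideal.Quotient.mkₐ_eq_mk k, ← map_smul, MvPolynomial.smul_monomial, smul_eq_mul, mul_one]

open Classical in
/-- The `k`-linear map `A → NB` with `v ↦ [v|c]` for a standard monomial `v ≠ 1`, and `1 ↦ 0`. -/
noncomputable def barCons (c : Cell m a) : QuotAlg a →ₗ[k] (Cell m a →₀ QuotAlg a) :=
  (standardBasis m a).constr k fun v =>
    if h : v.1 ≠ 0 then Finsupp.single (⟨v.1, h, v.2⟩ :: c) 1 else 0

open Classical in
theorem barCons_standardBasis (c : Cell m a) (v : {v | IsStandard m a v}) :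
    barCons c (standardBasis m a v) =
      if h : v.1 ≠ 0 then Finsupp.single (⟨v.1, h, v.2⟩ :: c) 1 else 0 :=
  (standardBasis m a).constr_basis k _ v

theorem barCons_monomial (c : Cell m a) (v : StdMon m a) :
    barCons c (Ideal.Quotient.mk a (monomial v.1 1)) = Finsupp.single (v :: c) 1 := by
  rw [← standardBasis_apply ⟨v.1, v.2.2⟩, barCons_standardBasis, dif_pos v.2.1]

theorem barCons_one (c : Cell m a) : barCons c 1 = 0 := by
  have h1 : Ideal.Quotient.mk a (monomial 0 1) = 1 := map_one _
  by_cases h0 : IsStandard m a 0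
  · rw [← h1, ← standardBasis_apply ⟨0, h0⟩, barCons_standardBasis, dif_neg (by simp)]
  · have hsupp : (normalForm m a (monomial 0 (1 : k))).support = ∅ := by
      refine Finset.eq_empty_of_forall_notMem fun v hv => ?_
      rcases eq_or_lt_of_mem_support_normalForm hv with rfl | hlt
      · exact h0 (.of_mem_support_normalForm hv)
      · exact (m.zero_le (m.toSyn v)).not_gt (by simpa using hlt)
    rw [← h1, mk_eq_sum_normalForm (m := m), hsupp, Finset.sum_empty, map_zero]

open Classical in
theorem barCons_mk (c : Cell m a) (f : MvPolynomial (Fin n) k) :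
    barCons c (Ideal.Quotient.mk a f) =
      ∑ v ∈ (normalForm m a f).support.subtype (fun v => v ≠ 0 ∧ IsStandard m a v),
        Finsupp.single (v :: c) (algebraMap k (QuotAlg a) ((normalForm m a f).coeff v.1)) := by
  have hsum : barCons c (Ideal.Quotient.mk a f) =
      ∑ v ∈ (normalForm m a f).support, (normalForm m a f).coeff v •
        barCons c (Ideal.Quotient.mk a (monomial v 1)) := by
    rw [mk_eq_sum_normalForm (m := m), map_sum]
    exact Finset.sum_congr rfl fun v _ => map_smul ..
  rw [hsum, ← Finset.sum_filter_of_ne (p := fun v => v ≠ 0 ∧ IsStandard m a v),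
    ← Finset.sum_subtype_eq_sum_filter]
  · refine Finset.sum_congr rfl fun v _ => ?_
    rw [barCons_monomial, Finsupp.smul_single, Algebra.algebraMap_eq_smul_one]
  · rintro v hv hne
    refine ⟨?_, .of_mem_support_normalForm hv⟩
    rintro rfl
    exact hne (by rw [← MvPolynomial.C_apply, map_one, map_one, barCons_one, smul_zero])

theorem exists_of_barCons_apply_ne_zero {c d : Cell m a} {f : MvPolynomial (Fin n) k}
    (h : barCons c (Ideal.Quotient.mk a f) d ≠ 0) :
    ∃ v : StdMon m a, v.1 ∈ (normalForm m a f).support ∧ d = v :: c := by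
  classical
  rw [barCons_mk, Finset.sum_apply'] at h
  obtain ⟨v, hv, hvd⟩ := Finset.exists_ne_zero_of_sum_ne_zero h
  exact ⟨v, by simpa using hv, not_imp_comm.1 Finsupp.single_eq_of_ne hvd⟩

theorem mergeD_cons_cons (w w' : StdMon m a) (c : Cell m a) :
    mergeD m a (w :: w' :: c) = - barCons c (Ideal.Quotient.mk a (monomial (w.1 + w'.1) 1))
      - (mergeD m a (w' :: c)).mapDomain (fun c' => w :: c') := by
  rw [barCons_mk, mergeD]

variable (m a) in
/-- The `k`-span of the cells. -/
noncomputable def cellSpan : Submodule k (Cell m a →₀ QuotAlg a) :=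
  Submodule.span k (Set.range fun c => Finsupp.single c 1)

theorem single_one_mem_cellSpan (c : Cell m a) : Finsupp.single c 1 ∈ cellSpan m a :=
  Submodule.subset_span ⟨c, rfl⟩

theorem barCons_mem_cellSpan (c : Cell m a) (x : QuotAlg a) : barCons c x ∈ cellSpan m a := by
  obtain ⟨f, rfl⟩ := Ideal.Quotient.mk_surjective x
  rw [barCons_mk]
  refine Submodule.sum_mem _ fun v _ => ?_
  rw [Algebra.algebraMap_eq_smul_one, ← Finsupp.smul_single]
  exact Submodule.smul_mem _ _ (single_one_mem_cellSpan _)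

theorem mapDomain_cons_mem_cellSpan (w : StdMon m a) {x : Cell m a →₀ QuotAlg a}
    (hx : x ∈ cellSpan m a) : x.mapDomain (List.cons w) ∈ cellSpan m a := by
  suffices h : cellSpan m a ≤
      (cellSpan m a).comap (Finsupp.lmapDomain (QuotAlg a) k (List.cons w)) from h hx
  refine Submodule.span_le.2 (Set.range_subset_iff.2 fun c => ?_)
  rw [SetLike.mem_coe, Submodule.mem_comap, Finsupp.lmapDomain_apply, Finsupp.mapDomain_single]
  exact single_one_mem_cellSpan _

theorem mergeD_mem_cellSpan : ∀ c : Cell m a, mergeD m a c ∈ cellSpan m a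
  | [] => by simp [mergeD]
  | [_] => by simp [mergeD]
  | w :: w' :: c => by
    rw [mergeD_cons_cons]
    exact sub_mem (neg_mem (barCons_mem_cellSpan _ _))
      (mapDomain_cons_mem_cellSpan w (mergeD_mem_cellSpan (w' :: c)))

end Bar

section Merges

variable (m : MonomialOrder (Fin n)) (a : Ideal (MvPolynomial (Fin n) k))

/-- Two neighbours in the first cell are replaced by a monomial of the normal form of their product:
the cells `d` that can occur in the inner part of the bar differential of `c`. -/
abbrev Merges : Cell m a → Cell m a → Prop :=
  ListMerge fun u v w => w.1 ∈ (normalForm m a (monomial (u.1 + v.1) (1 : k))).support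

/-- Two neighbours in the first cell are replaced by their product. -/
abbrev StdMerges : Cell m a → Cell m a → Prop :=
  ListMerge fun u v w => w.1 = u.1 + v.1

variable {m a}

theorem Merges.of_mergeD_ne_zero :
    ∀ {c d : Cell m a}, mergeD m a c d ≠ 0 → Merges m a c d
  | [], d, h => by simp [mergeD] at h
  | [w], d, h => by simp [mergeD] at h
  | w :: w' :: c, d, h => by
    rw [mergeD_cons_cons, Finsupp.sub_apply, Finsupp.neg_apply] at h
    by_cases h1 : barCons c (Ideal.Quotient.mk a (monomial (w.1 + w'.1) 1)) d = 0
    · rw [h1, neg_zero, zero_sub, neg_ne_zero] at h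
      by_cases h2 : d ∈ Set.range (List.cons w)
      · obtain ⟨d, rfl⟩ := h2
        rw [Finsupp.mapDomain_apply List.cons_injective] at h
        exact .cons (of_mergeD_ne_zero h)
      · exact (h (Finsupp.mapDomain_of_notMem_range _ _ h2)).elim
    · obtain ⟨v, hv, rfl⟩ := exists_of_barCons_apply_ne_zero h1
      exact .head hv

theorem mergeD_nil_right (c : Cell m a) : mergeD m a c [] = 0 := by
  by_contra h
  cases Merges.of_mergeD_ne_zero h

theorem Merges.of_barD_ne_zero {c d : Cell m a} (h : barD m a c d ≠ 0) :
    (∃ w, c = w :: d) ∨ Merges m a c d := by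
  match c, h with
  | [], h => simp [barD] at h
  | w :: c, h =>
    by_cases hd : d = c
    · exact .inl ⟨w, by rw [hd]⟩
    · rw [barD, Finsupp.add_apply, Finsupp.single_eq_of_ne hd, zero_add] at h
      exact .inr (of_mergeD_ne_zero h)

theorem isGraded_barD : AlgMorse.IsGraded (barD m a) List.length := by
  intro c d h
  rcases Merges.of_barD_ne_zero h with ⟨w, rfl⟩ | h
  · rfl
  · exact h.length_eq

theorem mk_monomial_mem_maxIdeal {v : Fin n →₀ ℕ} (hv : v ≠ 0) :
    Ideal.Quotient.mk a (monomial v 1) ∈ maxIdeal a := by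
  obtain ⟨i, hi⟩ := Finsupp.ne_iff.1 hv
  have hle : Finsupp.single i 1 ≤ v := by
    rw [Finsupp.single_le_iff]
    exact Nat.one_le_iff_ne_zero.2 hi
  rw [← add_tsub_cancel_of_le hle, ← one_mul (1 : k), ← MvPolynomial.monomial_mul, map_mul]
  exact Ideal.mul_mem_right _ _ (Ideal.subset_span ⟨i, rfl⟩)

theorem barD_mem_maxIdeal_of_mergeD_eq_zero {c d : Cell m a} (h : mergeD m a c d = 0) :
    barD m a c d ∈ maxIdeal a := by
  match c, h with
  | [], _ => simp [barD]
  | w :: c, h =>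
    rw [barD, Finsupp.add_apply, h, add_zero]
    by_cases hd : d = c
    · rw [hd, Finsupp.single_eq_same]
      exact mk_monomial_mem_maxIdeal w.2.1
    · rw [Finsupp.single_eq_of_ne hd]
      exact zero_mem _

end Merges

section Homotopy

open AlgMorse

variable (m : MonomialOrder (Fin n)) (a : Ideal (MvPolynomial (Fin n) k))

/-- The contracting homotopy `v[w₁|…|w_l] ↦ [v|w₁|…|w_l]` of the bar resolution. -/
noncomputable def homotopy : (Cell m a →₀ QuotAlg a) →ₗ[k] (Cell m a →₀ QuotAlg a) :=
  Finsupp.lsum k barCons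

variable {m a}

theorem homotopy_single (c : Cell m a) (x : QuotAlg a) :
    homotopy m a (Finsupp.single c x) = barCons c x :=
  Finsupp.lsum_single ..

theorem homotopy_eq_zero {x : Cell m a →₀ QuotAlg a} (hx : x ∈ cellSpan m a) :
    homotopy m a x = 0 := by
  suffices h : cellSpan m a ≤ LinearMap.ker (homotopy m a) from h hx
  refine Submodule.span_le.2 (Set.range_subset_iff.2 fun c => ?_)
  rw [SetLike.mem_coe, LinearMap.mem_ker, homotopy_single, barCons_one]

theorem homotopy_smul (v : StdMon m a) {x : Cell m a →₀ QuotAlg a} (hx : x ∈ cellSpan m a) :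
    homotopy m a (Ideal.Quotient.mk a (monomial v.1 1) • x) = x.mapDomain (List.cons v) := by
  refine Submodule.span_induction ?_ (by simp) (fun x y _ _ hx hy => ?_) (fun b x _ h => ?_) hx
  · rintro _ ⟨c, rfl⟩
    dsimp only
    rw [Finsupp.smul_single, smul_eq_mul, mul_one, homotopy_single, barCons_monomial,
      Finsupp.mapDomain_single]
  · rw [smul_add, map_add, hx, hy, Finsupp.mapDomain_add]
  · rw [smul_comm, map_smul, h, Finsupp.mapDomain_smul]

theorem homotopy_mem_chains {i : ℕ} {x : Cell m a →₀ QuotAlg a}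
    (hx : x ∈ chains (QuotAlg a) List.length i) :
    homotopy m a x ∈ chains (QuotAlg a) List.length (i + 1) := by
  rw [homotopy, Finsupp.lsum_apply]
  refine Submodule.sum_mem _ fun c hc d hd => ?_
  obtain ⟨f, hf⟩ := Ideal.Quotient.mk_surjective (x c)
  rw [Finset.mem_coe, Finsupp.mem_support_iff, ← hf] at hd
  obtain ⟨v, -, rfl⟩ := exists_of_barCons_apply_ne_zero hd
  simpa using hx hc

/-- The augmentation `A → k` sending the variables to `0`. -/
noncomputable def augmentation (ha : a ≤ RingHom.ker (MvPolynomial.constantCoeff)) :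
    QuotAlg a →ₐ[k] k :=
  Ideal.Quotient.liftₐ a (MvPolynomial.aeval 0) fun f hf => by
    simpa using ha hf

theorem maxIdeal_le_ker_augmentation (ha : a ≤ RingHom.ker (MvPolynomial.constantCoeff)) :
    maxIdeal a ≤ RingHom.ker (augmentation ha) := by
  refine Ideal.span_le.2 (Set.range_subset_iff.2 fun i => ?_)
  exact MvPolynomial.aeval_X 0 i

theorem augmentation_monomial (ha : a ≤ RingHom.ker (MvPolynomial.constantCoeff))
    {v : Fin n →₀ ℕ} (hv : v ≠ 0) :
    augmentation ha (Ideal.Quotient.mk a (monomial v 1)) = 0 :=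
  maxIdeal_le_ker_augmentation ha (mk_monomial_mem_maxIdeal hv)

theorem linearMap_ext_cells {N : Type*} [AddCommMonoid N] [Module k N]
    {f g : (Cell m a →₀ QuotAlg a) →ₗ[k] N}
    (h1 : ∀ c, f (Finsupp.single c 1) = g (Finsupp.single c 1))
    (hv : ∀ c (v : StdMon m a), f (Finsupp.single c (Ideal.Quotient.mk a (monomial v.1 1))) =
      g (Finsupp.single c (Ideal.Quotient.mk a (monomial v.1 1)))) : f = g := by
  refine Finsupp.lhom_ext' fun c => (standardBasis m a).ext fun ⟨v, hstd⟩ => ?_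
  rw [standardBasis_apply, LinearMap.comp_apply, LinearMap.comp_apply, Finsupp.lsingle_apply]
  obtain rfl | h0 := eq_or_ne v 0
  · exact h1 c
  · exact hv c ⟨v, h0, hstd⟩

theorem boundary_homotopy_add_homotopy_boundary
    (ha : a ≤ RingHom.ker (MvPolynomial.constantCoeff)) (x : Cell m a →₀ QuotAlg a) :
    boundary (barD m a) (homotopy m a x) + homotopy m a (boundary (barD m a) x) =
      x - Finsupp.single [] (algebraMap k (QuotAlg a) (augmentation ha (x []))) := by
  suffices h : (boundary (barD m a)).restrictScalars k ∘ₗ homotopy m a +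
      homotopy m a ∘ₗ (boundary (barD m a)).restrictScalars k =
      LinearMap.id - Finsupp.lsingle [] ∘ₗ Algebra.linearMap k (QuotAlg a) ∘ₗ
        (augmentation ha).toLinearMap ∘ₗ Finsupp.lapply [] from LinearMap.congr_fun h x
  refine linearMap_ext_cells (fun c => ?_) fun c v => ?_
  · suffices homotopy m a (barD m a c) = Finsupp.single c 1 -
        Finsupp.single [] (algebraMap k _ (augmentation ha (Finsupp.single c 1 []))) by
      simpa [homotopy_single, barCons_one, boundary_single_one]
    match c with
    | [] => simp [barD]
    | w :: c =>
      simp [barD, homotopy_single, barCons_monomial, homotopy_eq_zero (mergeD_mem_cellSpan _)]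
  · suffices barD m a (v :: c) +
        homotopy m a (Ideal.Quotient.mk a (monomial v.1 1) • barD m a c) =
        Finsupp.single c (Ideal.Quotient.mk a (monomial v.1 1)) by
      have haug : augmentation ha
          (Finsupp.single c (Ideal.Quotient.mk a (monomial v.1 1)) []) = 0 := by
        cases c <;> simp [augmentation_monomial ha v.2.1]
      simpa only [LinearMap.add_apply, LinearMap.sub_apply, LinearMap.comp_apply,
        LinearMap.restrictScalars_apply, LinearMap.id_apply, Finsupp.lapply_apply,
        AlgHom.toLinearMap_apply, haug, map_zero, sub_zero, homotopy_single, barCons_monomial,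
        boundary_single_one, boundary, Finsupp.linearCombination_single, one_smul]
    match c with
    | [] => simp [barD, mergeD]
    | w :: c =>
      rw [barD, barD, mergeD_cons_cons, smul_add, map_add, homotopy_smul v (mergeD_mem_cellSpan _),
        Finsupp.smul_single, smul_eq_mul, ← map_mul, MvPolynomial.monomial_mul, one_mul,
        homotopy_single]
      abel

theorem boundary_apply_nil_mem_maxIdeal (x : Cell m a →₀ QuotAlg a) :
    boundary (barD m a) x [] ∈ maxIdeal a := by
  rw [boundary, Finsupp.linearCombination_apply, Finsupp.sum_apply]
  refine Submodule.sum_mem _ fun c _ => Ideal.mul_mem_left _ _ ?_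
  exact barD_mem_maxIdeal_of_mergeD_eq_zero (mergeD_nil_right c)

theorem boundary_single_nil (x : QuotAlg a) :
    boundary (barD m a) (Finsupp.single [] x) = 0 := by
  simp [boundary, barD]

theorem boundary_boundary_homotopy (ha : a ≤ RingHom.ker (MvPolynomial.constantCoeff))
    {x : Cell m a →₀ QuotAlg a} (hx : boundary (barD m a) (boundary (barD m a) x) = 0) :
    boundary (barD m a) (boundary (barD m a) (homotopy m a x)) = 0 := by
  have haug : augmentation ha (boundary (barD m a) x []) = 0 :=
    maxIdeal_le_ker_augmentation ha (boundary_apply_nil_mem_maxIdeal x)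
  have hbdry : boundary (barD m a) (homotopy m a (boundary (barD m a) x)) =
      boundary (barD m a) x := by
    have h := boundary_homotopy_add_homotopy_boundary ha (boundary (barD m a) x)
    rwa [hx, haug, map_zero, map_zero, Finsupp.single_zero, add_zero, sub_zero] at h
  rw [eq_sub_of_add_eq (boundary_homotopy_add_homotopy_boundary ha x), map_sub, map_sub, hbdry,
    boundary_single_nil, sub_zero, sub_self]

theorem boundary_comp_boundary (ha : a ≤ RingHom.ker (MvPolynomial.constantCoeff)) :
    boundary (barD m a) ∘ₗ boundary (barD m a) = 0 := by
  suffices h : ∀ c, boundary (barD m a) (boundary (barD m a) (Finsupp.single c 1)) = 0 from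
    Finsupp.lhom_ext' fun c => LinearMap.ext_ring (h c)
  intro c
  induction c with
  | nil => rw [boundary_single_nil, map_zero]
  | cons w c ih =>
    rw [← barCons_monomial, ← homotopy_single]
    refine boundary_boundary_homotopy ha ?_
    rw [← Finsupp.smul_single_one, map_smul, map_smul, ih, smul_zero]

theorem mem_map_boundary_of_boundary_eq_zero
    (ha : a ≤ RingHom.ker (MvPolynomial.constantCoeff)) {i : ℕ} {x : Cell m a →₀ QuotAlg a}
    (hx : x ∈ chains (QuotAlg a) List.length i) (h0 : boundary (barD m a) x = 0)
    (haug : augmentation ha (x []) = 0) :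
    x ∈ (chains (QuotAlg a) List.length (i + 1)).map (boundary (barD m a)) := by
  refine ⟨homotopy m a x, homotopy_mem_chains hx, ?_⟩
  have h := boundary_homotopy_add_homotopy_boundary ha x
  rwa [h0, haug, map_zero, map_zero, Finsupp.single_zero, add_zero, sub_zero] at h

theorem mem_map_boundary_of_mem_chains_succ
    (ha : a ≤ RingHom.ker (MvPolynomial.constantCoeff)) {i : ℕ} {x : Cell m a →₀ QuotAlg a}
    (hx : x ∈ chains (QuotAlg a) List.length (i + 1)) (h0 : boundary (barD m a) x = 0) :
    x ∈ (chains (QuotAlg a) List.length (i + 2)).map (boundary (barD m a)) := by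
  have hnil : x [] = 0 := (Finsupp.mem_supported' _ _).1 hx _ (by simp)
  exact mem_map_boundary_of_boundary_eq_zero ha hx h0 (by rw [hnil, map_zero])

theorem mkQ_maxIdeal_apply_nil_eq_zero_iff
    (ha : a ≤ RingHom.ker (MvPolynomial.constantCoeff)) {x : Cell m a →₀ QuotAlg a}
    (hx : x ∈ chains (QuotAlg a) List.length 0) :
    (maxIdeal a).mkQ (x []) = 0 ↔
      x ∈ (chains (QuotAlg a) List.length 1).map (boundary (barD m a)) := by
  rw [Submodule.mkQ_apply, Submodule.Quotient.mk_eq_zero]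
  constructor
  · intro h
    have hsingle : x = Finsupp.single [] (x []) := by
      ext c
      cases c with
      | nil => simp
      | cons w c =>
        rw [(Finsupp.mem_supported' _ _).1 hx _ (by simp), Finsupp.single_eq_of_ne (by simp)]
    refine mem_map_boundary_of_boundary_eq_zero ha hx ?_ (maxIdeal_le_ker_augmentation ha h)
    rw [hsingle, boundary_single_nil]
  · rintro ⟨y, -, rfl⟩
    exact boundary_apply_nil_mem_maxIdeal y

end Homotopy

/-! ## The matching in terms of allowed letters -/

section Degrees

variable {m : MonomialOrder (Fin n)} {a : Ideal (MvPolynomial (Fin n) k)}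

/-- The exponent of the product of the entries of a cell. -/
noncomputable def Cell.total (c : Cell m a) : Fin n →₀ ℕ := (c.map Subtype.val).sum

@[simp]
theorem Cell.total_nil : Cell.total ([] : Cell m a) = 0 := rfl

@[simp]
theorem Cell.total_cons (w : StdMon m a) (c : Cell m a) :
    Cell.total (w :: c) = w.1 + Cell.total c := rfl

theorem Cell.total_cons_ne (w : StdMon m a) (c : Cell m a) :
    Cell.total (w :: c) ≠ Cell.total c := fun h => w.2.1 (by simpa using h)

theorem StdMon.degree_pos (w : StdMon m a) : 0 < w.1.degree :=
  Nat.pos_of_ne_zero fun h => w.2.1 ((Finsupp.degree_eq_zero_iff _).1 h)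

theorem Cell.length_le_degree_total (c : Cell m a) : c.length ≤ (Cell.total c).degree := by
  induction c with
  | nil => simp
  | cons w c ih =>
    have := w.degree_pos
    rw [Cell.total_cons, map_add, List.length_cons]
    omega

theorem Merges.degree_total
    (ha : a.IsHomogeneous (MvPolynomial.homogeneousSubmodule (Fin n) k)) {c d : Cell m a}
    (h : Merges m a c d) : (Cell.total d).degree = (Cell.total c).degree := by
  induction h with
  | head h =>
    have := degree_eq_of_mem_support_normalForm ha h
    simp only [Cell.total_cons, map_add] at this ⊢
    omega
  | cons _ ih => simp [ih]

theorem Merges.total_lt_or_stdMerges {c d : Cell m a} (h : Merges m a c d) :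
    Cell.total d ≺[m] Cell.total c ∨ StdMerges m a c d := by
  induction h with
  | @head u v w q h =>
    rcases eq_or_lt_of_mem_support_normalForm h with h | h
    · exact .inr (.head h)
    · left
      rw [Cell.total_cons, Cell.total_cons, Cell.total_cons, ← add_assoc, map_add,
        map_add _ (u.1 + v.1)]
      exact add_lt_add_left h _
  | cons _ ih =>
    rcases ih with ih | ih
    · left
      rw [Cell.total_cons, Cell.total_cons, map_add, map_add]
      exact add_lt_add_right ih _
    · exact .inr (.cons ih)

theorem StdMerges.total_eq {c d : Cell m a} (h : StdMerges m a c d) :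
    Cell.total d = Cell.total c := by
  induction h with
  | head h => simp [h, add_assoc]
  | cons _ ih => simp [ih]

theorem StdMerges.isUnit_mergeD {c d : Cell m a} (h : StdMerges m a c d) :
    IsUnit (mergeD m a c d) := by
  induction h with
  | @head u v w q h =>
    have hrange : w :: q ∉ Set.range (List.cons u) := by
      rintro ⟨_, heq⟩
      obtain rfl : u = w := (List.cons.inj heq).1
      exact v.2.1 (by simpa using h)
    rw [mergeD_cons_cons, Finsupp.sub_apply, Finsupp.neg_apply, ← h, barCons_monomial,
      Finsupp.mapDomain_of_notMem_range _ _ hrange, Finsupp.single_eq_same, sub_zero]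
    exact (isUnit_one (M := QuotAlg a)).neg
  | @cons u c d h ih =>
    have htot := StdMerges.total_eq h
    match c, ih with
    | t :: c, ih =>
      have hhead : barCons c (Ideal.Quotient.mk a (monomial (u.1 + t.1) 1)) (u :: d) = 0 := by
        by_contra hne
        obtain ⟨v, -, hv⟩ := exists_of_barCons_apply_ne_zero hne
        rw [(List.cons.inj hv).2] at htot
        exact Cell.total_cons_ne t c htot.symm
      rw [mergeD_cons_cons, Finsupp.sub_apply, Finsupp.neg_apply, hhead,
        Finsupp.mapDomain_apply List.cons_injective, neg_zero, zero_sub]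
      exact ih.neg

theorem StdMerges.isUnit_barD {c d : Cell m a} (h : StdMerges m a c d) :
    IsUnit (barD m a c d) := by
  match c, h with
  | w :: c, h =>
    have hne : d ≠ c := by
      rintro rfl
      exact Cell.total_cons_ne w d (StdMerges.total_eq h).symm
    rw [barD, Finsupp.add_apply, Finsupp.single_eq_of_ne hne, zero_add]
    exact StdMerges.isUnit_mergeD h

theorem barD_mem_maxIdeal
    (ha : a.IsHomogeneous (MvPolynomial.homogeneousSubmodule (Fin n) k)) {c d : Cell m a}
    (h : (Cell.total d).degree < (Cell.total c).degree) : barD m a c d ∈ maxIdeal a := by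
  refine barD_mem_maxIdeal_of_mergeD_eq_zero ?_
  by_contra hne
  exact h.ne (Merges.degree_total ha (Merges.of_mergeD_ne_zero hne))

end Degrees

section Letters

variable (m : MonomialOrder (Fin n)) (a : Ideal (MvPolynomial (Fin n) k))

/-- The letters in `L` that divide the monomial with exponent `w`. -/
def lettersIn (L : Set (Fin n)) (w : Fin n →₀ ℕ) : Set (Fin n) := {j | j ∈ L ∧ w j ≠ 0}

/-- The letters that are allowed after the letter `i` has been read while the letters in `L` were
allowed: those `l` for which `x_i x_l` is not standard, and the letters in `L` smaller than `i`. -/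
def nextLetters (L : Set (Fin n)) (i : Fin n) : Set (Fin n) :=
  {l | ¬ IsStandard m a (Finsupp.single i 1 + Finsupp.single l 1) ∨ l < i ∧ l ∈ L}

/-- The edges of the matching in position `j + 1` in terms of the letters that are allowed in the
first position: the entries before that position are allowed letters `x_i`, and the entry `w` of
the target there is split into its least allowed letter and the rest. -/
inductive LetterMatchingAt : ℕ → Set (Fin n) → Cell m a → Cell m a → Prop
  | head {L : Set (Fin n)} {u v w : StdMon m a} {q : Cell m a} {i : Fin n}
      (hi : IsLeast (lettersIn L w.1) i) (hu : u.1 = Finsupp.single i 1) (hw : w.1 = u.1 + v.1) :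
      LetterMatchingAt 0 L (u :: v :: q) (w :: q)
  | cons {j : ℕ} {L : Set (Fin n)} {u : StdMon m a} {c d : Cell m a} {i : Fin n} (hi : i ∈ L)
      (hu : u.1 = Finsupp.single i 1) (h : LetterMatchingAt j (nextLetters m a L i) c d) :
      LetterMatchingAt (j + 1) L (u :: c) (u :: d)

/-- The union of the matchings `LetterMatchingAt` over all positions. -/
def LetterMatching (L : Set (Fin n)) (c d : Cell m a) : Prop :=
  ∃ j, LetterMatchingAt m a j L c d

variable {m a}

theorem exists_isLeast_lettersIn {L : Set (Fin n)} {w : Fin n →₀ ℕ}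
    (h : (lettersIn L w).Nonempty) : ∃ i, IsLeast (lettersIn L w) i :=
  ⟨_, WellFounded.min_mem wellFounded_lt _ h, fun _ hx => WellFounded.min_le wellFounded_lt hx⟩

theorem isLeast_lettersIn_of_eq_single {L : Set (Fin n)} {w : Fin n →₀ ℕ} {i : Fin n}
    (hi : i ∈ L) (hw : w = Finsupp.single i 1) : IsLeast (lettersIn L w) i := by
  refine ⟨⟨hi, by simp [hw]⟩, ?_⟩
  rintro l ⟨-, hl⟩
  rw [hw, Finsupp.single_apply_ne_zero] at hl
  exact hl.1.ge

theorem eq_of_eq_single {i j : Fin n} {u : Fin n →₀ ℕ} (hi : u = Finsupp.single i 1)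
    (hj : u = Finsupp.single j 1) : j = i :=
  (Finsupp.single_left_injective one_ne_zero (hi.symm.trans hj)).symm

theorem StdMon.ne_single_of_eq_add {u v w : StdMon m a} (hw : w.1 = u.1 + v.1) (i : Fin n) :
    w.1 ≠ Finsupp.single i 1 := by
  intro h
  have hdeg := congrArg Finsupp.degree (hw.symm.trans h)
  have hu := u.degree_pos
  have hv := v.degree_pos
  rw [map_add, Finsupp.degree_single] at hdeg
  omega

theorem StdMon.exists_eq_single_add (w : StdMon m a) {i : Fin n} (hi : w.1 i ≠ 0)
    (hne : w.1 ≠ Finsupp.single i 1) :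
    ∃ u v : StdMon m a, u.1 = Finsupp.single i 1 ∧ w.1 = u.1 + v.1 := by
  have hle : Finsupp.single i 1 ≤ w.1 :=
    Finsupp.single_le_iff.2 (Nat.one_le_iff_ne_zero.2 hi)
  refine ⟨⟨Finsupp.single i 1, by simp, w.2.2.mono hle⟩,
    ⟨w.1 - Finsupp.single i 1, fun h => ?_, w.2.2.mono tsub_le_self⟩, rfl,
    (add_tsub_cancel_of_le hle).symm⟩
  exact hne (le_antisymm (tsub_eq_zero_iff_le.1 h) hle)

theorem lettersIn_nextLetters_eq_empty {L : Set (Fin n)} {u v w : StdMon m a} {i : Fin n}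
    (hi : IsLeast (lettersIn L w.1) i) (hu : u.1 = Finsupp.single i 1) (hw : w.1 = u.1 + v.1) :
    lettersIn (nextLetters m a L i) v.1 = ∅ := by
  refine Set.eq_empty_of_forall_notMem ?_
  rintro l ⟨hl | ⟨hl, hlL⟩, hvl⟩
  · refine hl (w.2.2.mono ?_)
    rw [hw, hu]
    gcongr
    exact Finsupp.single_le_iff.2 (Nat.one_le_iff_ne_zero.2 hvl)
  · have hmem : l ∈ lettersIn L w.1 := ⟨hlL, by simp [hw, hvl]⟩
    exact absurd (hi.2 hmem) (not_le.2 hl)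

theorem isLeast_lettersIn_add {L : Set (Fin n)} {i : Fin n} (hi : i ∈ L) {w v : StdMon m a}
    (hw : w.1 = Finsupp.single i 1) (h : lettersIn (nextLetters m a L i) v.1 = ∅) :
    IsLeast (lettersIn L (w.1 + v.1)) i := by
  refine ⟨⟨hi, by simp [hw]⟩, ?_⟩
  rintro l ⟨hlL, hl⟩
  by_contra hli
  have hli : l < i := not_le.1 hli
  refine Set.eq_empty_iff_forall_notMem.1 h l ⟨.inr ⟨hli, hlL⟩, fun h0 => hl ?_⟩
  simp [hw, h0, hli.ne]

theorem HasQuadraticInitialIdeal.isStandard_add (hq : HasQuadraticInitialIdeal m a)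
    {L : Set (Fin n)} {i : Fin n} {w v : StdMon m a} (hw : w.1 = Finsupp.single i 1)
    (h : lettersIn (nextLetters m a L i) v.1 = ∅) : IsStandard m a (w.1 + v.1) := by
  by_contra hns
  obtain ⟨i', l, hi', hl, hil⟩ := hq.exists_of_not_isStandard_add w.2.2 v.2.2 hns
  rw [hw, Finsupp.single_apply_ne_zero] at hi'
  obtain rfl := hi'.1
  exact Set.eq_empty_iff_forall_notMem.1 h l ⟨.inl hil, hl⟩

namespace LetterMatchingAt

theorem lettersIn_source_nonempty {j : ℕ} {L : Set (Fin n)} {w : StdMon m a} {c d : Cell m a}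
    (h : LetterMatchingAt m a j L (w :: c) d) : (lettersIn L w.1).Nonempty := by
  cases h with
  | head hi hu _ => exact ⟨_, hi.1.1, by simp [hu]⟩
  | cons hi hu _ => exact ⟨_, hi, by simp [hu]⟩

theorem lettersIn_target_nonempty {j : ℕ} {L : Set (Fin n)} {w : StdMon m a} {c d : Cell m a}
    (h : LetterMatchingAt m a j L c (w :: d)) : (lettersIn L w.1).Nonempty := by
  cases h with
  | head hi _ _ => exact ⟨_, hi.1⟩
  | cons hi hu _ => exact ⟨_, hi, by simp [hu]⟩

theorem stdMerges {j : ℕ} {L : Set (Fin n)} {c d : Cell m a}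
    (h : LetterMatchingAt m a j L c d) : StdMerges m a c d := by
  induction h with
  | head _ _ hw => exact .head hw
  | cons _ _ _ ih => exact .cons ih

theorem not_source_of_head {j : ℕ} {L : Set (Fin n)} {u v w : StdMon m a} {i : Fin n}
    {q d : Cell m a} (hi : IsLeast (lettersIn L w.1) i) (hu : u.1 = Finsupp.single i 1)
    (hw : w.1 = u.1 + v.1) : ¬ LetterMatchingAt m a j (nextLetters m a L i) (v :: q) d :=
  fun h => h.lettersIn_source_nonempty.ne_empty (lettersIn_nextLetters_eq_empty hi hu hw)

theorem target_unique {j j' : ℕ} {L : Set (Fin n)} {c d d' : Cell m a}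
    (h : LetterMatchingAt m a j L c d) (h' : LetterMatchingAt m a j' L c d') : d = d' := by
  induction h generalizing j' d' with
  | head hi hu hw =>
    cases h' with
    | head _ _ hw' => rw [Subtype.ext (hw.trans hw'.symm)]
    | cons _ hu' h' =>
      obtain rfl := eq_of_eq_single hu hu'
      exact (not_source_of_head hi hu hw h').elim
  | cons hi hu h ih =>
    cases h' with
    | head hi' hu' hw' =>
      obtain rfl := eq_of_eq_single hu hu'
      exact (not_source_of_head hi' hu' hw' h).elim
    | cons _ hu' h' =>
      obtain rfl := eq_of_eq_single hu hu'
      rw [ih h']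

theorem source_unique {j j' : ℕ} {L : Set (Fin n)} {c c' d : Cell m a}
    (h : LetterMatchingAt m a j L c d) (h' : LetterMatchingAt m a j' L c' d) : c = c' := by
  induction h generalizing j' c' with
  | @head L u v w q i hi hu hw =>
    cases h' with
    | @head _ u' _ _ _ _ hi' hu' hw' =>
      obtain rfl := hi.unique hi'
      obtain rfl : u = u' := Subtype.ext (hu.trans hu'.symm)
      rw [Subtype.ext (add_left_cancel (hw.symm.trans hw'))]
    | cons _ hu' _ => exact (StdMon.ne_single_of_eq_add hw _ hu').elim
  | cons hi hu h ih =>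
    cases h' with
    | head _ _ hw' => exact (StdMon.ne_single_of_eq_add hw' _ hu).elim
    | cons _ hu' h' =>
      obtain rfl := eq_of_eq_single hu hu'
      rw [ih h']

theorem not_source_of_target {j j' : ℕ} {L : Set (Fin n)} {c d e : Cell m a}
    (h : LetterMatchingAt m a j L c d) : ¬ LetterMatchingAt m a j' L d e := by
  intro h'
  induction h generalizing j' e with
  | head _ _ hw =>
    cases h' with
    | head _ hu' _ => exact StdMon.ne_single_of_eq_add hw _ hu'
    | cons _ hu' _ => exact StdMon.ne_single_of_eq_add hw _ hu'
  | cons hi hu h ih =>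
    cases h' with
    | head hi' hu' hw' =>
      obtain rfl := eq_of_eq_single hu hu'
      exact h.lettersIn_target_nonempty.ne_empty (lettersIn_nextLetters_eq_empty hi' hu' hw')
    | cons _ hu' h' =>
      obtain rfl := eq_of_eq_single hu hu'
      exact ih h'

end LetterMatchingAt

end Letters

section Acyclicity

variable {m : MonomialOrder (Fin n)} {a : Ideal (MvPolynomial (Fin n) k)}

open Classical in
/-- The least allowed letters of the entries of a cell, up to the first entry that is not a letter.
The letters are ordered reversely: words are compared lexicographically, and splitting off a smaller
letter gives a larger word. -/
noncomputable def letterWord : Set (Fin n) → Cell m a → List (Fin n)ᵒᵈ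
  | _, [] => []
  | L, w :: c =>
    if h : ∃ i, IsLeast (lettersIn L w.1) i then
      OrderDual.toDual h.choose ::
        if w.1 = Finsupp.single h.choose 1 then letterWord (nextLetters m a L h.choose) c else []
    else []

theorem letterWord_of_eq_empty {L : Set (Fin n)} {w : StdMon m a} (h : lettersIn L w.1 = ∅)
    (c : Cell m a) : letterWord L (w :: c) = [] := by
  rw [letterWord, dif_neg]
  rintro ⟨i, hi⟩
  exact Set.eq_empty_iff_forall_notMem.1 h i hi.1

theorem letterWord_of_ne_single {L : Set (Fin n)} {w : StdMon m a} {i : Fin n}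
    (hi : IsLeast (lettersIn L w.1) i) (hne : w.1 ≠ Finsupp.single i 1) (c : Cell m a) :
    letterWord L (w :: c) = [OrderDual.toDual i] := by
  have h : ∃ i, IsLeast (lettersIn L w.1) i := ⟨i, hi⟩
  obtain rfl := hi.unique h.choose_spec
  rw [letterWord, dif_pos h, if_neg hne]

theorem letterWord_of_eq_single {L : Set (Fin n)} {w : StdMon m a} {i : Fin n} (hi : i ∈ L)
    (hw : w.1 = Finsupp.single i 1) (c : Cell m a) :
    letterWord L (w :: c) = OrderDual.toDual i :: letterWord (nextLetters m a L i) c := by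
  have h : ∃ i, IsLeast (lettersIn L w.1) i := ⟨i, isLeast_lettersIn_of_eq_single hi hw⟩
  obtain rfl := (isLeast_lettersIn_of_eq_single hi hw).unique h.choose_spec
  rw [letterWord, dif_pos h, if_pos hw]

theorem length_letterWord_le (L : Set (Fin n)) (c : Cell m a) :
    (letterWord L c).length ≤ c.length := by
  induction c generalizing L with
  | nil => simp [letterWord]
  | cons w c ih =>
    rw [letterWord]
    split_ifs
    · simpa using ih _
    · simp
    · simp

theorem LetterMatching.exists_source {L : Set (Fin n)} {w : StdMon m a} {i : Fin n}
    (hi : IsLeast (lettersIn L w.1) i) (hne : w.1 ≠ Finsupp.single i 1) (q : Cell m a) :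
    ∃ c, LetterMatching m a L c (w :: q) := by
  obtain ⟨u, v, hu, hw⟩ := w.exists_eq_single_add hi.1.2 hne
  exact ⟨_, 0, .head hi hu hw⟩

theorem LetterMatchingAt.letterWord_eq {j : ℕ} {L : Set (Fin n)} {c d : Cell m a}
    (h : LetterMatchingAt m a j L c d) : letterWord L c = letterWord L d := by
  induction h with
  | head hi hu hw =>
    rw [letterWord_of_ne_single hi (StdMon.ne_single_of_eq_add hw _),
      letterWord_of_eq_single hi.1.1 hu,
      letterWord_of_eq_empty (lettersIn_nextLetters_eq_empty hi hu hw)]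
  | cons hi hu _ ih => rw [letterWord_of_eq_single hi hu, letterWord_of_eq_single hi hu, ih]

theorem letterWord_lt_or_of_eq_add {u v w : StdMon m a} (hw : w.1 = u.1 + v.1) (L : Set (Fin n))
    (q : Cell m a) :
    letterWord L (u :: v :: q) < letterWord L (w :: q) ∨
      letterWord L (u :: v :: q) = letterWord L (w :: q) ∧
        ((∃ e, LetterMatching m a L e (w :: q)) →
          LetterMatching m a L (u :: v :: q) (w :: q) ∨
            ∃ e, LetterMatching m a L e (u :: v :: q)) := by
  have hne := StdMon.ne_single_of_eq_add hw
  have hsub : lettersIn L u.1 ⊆ lettersIn L w.1 := fun l hl => ⟨hl.1, by simp [hw, hl.2]⟩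
  rcases (lettersIn L w.1).eq_empty_or_nonempty with hLw | hLw
  · rw [letterWord_of_eq_empty (Set.subset_eq_empty hsub hLw), letterWord_of_eq_empty hLw]
    refine .inr ⟨rfl, fun ⟨e, j, he⟩ => ?_⟩
    exact (he.lettersIn_target_nonempty.ne_empty hLw).elim
  obtain ⟨j, hj⟩ := exists_isLeast_lettersIn hLw
  rw [letterWord_of_ne_single hj (hne j)]
  rcases (lettersIn L u.1).eq_empty_or_nonempty with hLu | hLu
  · rw [letterWord_of_eq_empty hLu]
    exact .inl (List.nil_lt_cons _ _)
  obtain ⟨i, hi⟩ := exists_isLeast_lettersIn hLu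
  have hji : j ≤ i := hj.2 (hsub hi.1)
  by_cases hui : u.1 = Finsupp.single i 1
  · rw [letterWord_of_eq_single hi.1.1 hui]
    rcases hji.lt_or_eq with hlt | rfl
    · exact .inl (List.cons_lt_cons_iff.2 (.inl hlt))
    · rw [letterWord_of_eq_empty (lettersIn_nextLetters_eq_empty hj hui hw)]
      exact .inr ⟨rfl, fun _ => .inl ⟨0, .head hj hui hw⟩⟩
  · rw [letterWord_of_ne_single hi hui]
    rcases hji.lt_or_eq with hlt | rfl
    · exact .inl (List.cons_lt_cons_iff.2 (.inl hlt))
    · exact .inr ⟨rfl, fun _ => .inr (LetterMatching.exists_source hi hui _)⟩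

theorem exists_letterMatching_cons_iff {L : Set (Fin n)} {u : StdMon m a} {i : Fin n} (hi : i ∈ L)
    (hu : u.1 = Finsupp.single i 1) {d : Cell m a} :
    (∃ e, LetterMatching m a L e (u :: d)) ↔
      ∃ e, LetterMatching m a (nextLetters m a L i) e d := by
  constructor
  · rintro ⟨e, j, h⟩
    cases h with
    | head _ _ hw => exact (StdMon.ne_single_of_eq_add hw _ hu).elim
    | cons _ hu' h =>
      obtain rfl := eq_of_eq_single hu hu'
      exact ⟨_, _, h⟩
  · rintro ⟨e, j, h⟩
    exact ⟨_, _, .cons hi hu h⟩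

theorem StdMerges.letterWord_lt_or {c d : Cell m a} (h : StdMerges m a c d) (L : Set (Fin n)) :
    letterWord L c < letterWord L d ∨ letterWord L c = letterWord L d ∧
      ((∃ e, LetterMatching m a L e d) →
        LetterMatching m a L c d ∨ ∃ e, LetterMatching m a L e c) := by
  induction h generalizing L with
  | head h => exact letterWord_lt_or_of_eq_add h L _
  | @cons u c d _ ih =>
    rcases (lettersIn L u.1).eq_empty_or_nonempty with hLu | hLu
    · rw [letterWord_of_eq_empty hLu, letterWord_of_eq_empty hLu]
      refine .inr ⟨rfl, fun ⟨e, j, he⟩ => ?_⟩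
      exact (he.lettersIn_target_nonempty.ne_empty hLu).elim
    obtain ⟨i, hi⟩ := exists_isLeast_lettersIn hLu
    by_cases hui : u.1 = Finsupp.single i 1
    · rw [letterWord_of_eq_single hi.1.1 hui, letterWord_of_eq_single hi.1.1 hui,
        List.cons_lt_cons_iff, exists_letterMatching_cons_iff hi.1.1 hui,
        exists_letterMatching_cons_iff hi.1.1 hui]
      rcases ih (nextLetters m a L i) with hlt | ⟨heq, hor⟩
      · exact .inl (.inr ⟨rfl, hlt⟩)
      · exact .inr ⟨by rw [heq], fun he =>
          (hor he).imp_left fun ⟨j, h⟩ => ⟨j + 1, .cons hi.1.1 hui h⟩⟩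
    · rw [letterWord_of_ne_single hi hui, letterWord_of_ne_single hi hui]
      exact .inr ⟨rfl, fun _ => .inr (LetterMatching.exists_source hi hui _)⟩

/-- The number of words that exceed the word of `c` and are no longer than the total degree, which
bounds the number of times the word can still increase at constant total degree. -/
noncomputable def wordCorank (c : Cell m a) : ℕ :=
  {l : List (Fin n)ᵒᵈ | l.length ≤ (Cell.total c).degree ∧ letterWord Set.univ c < l}.ncard

open Classical in
/-- The length of a cell, with a correction for the targets of the matching that makes it decrease
along the reversed edges too. -/
noncomputable def lengthRank (c : Cell m a) : ℕ :=
  2 * c.length + if ∃ e, LetterMatching m a Set.univ e c then 3 else 0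

/-- The quantity that decreases lexicographically along the steps of `G_M`. -/
noncomputable def cellRank (c : Cell m a) : m.syn ×ₗ ℕ ×ₗ ℕ :=
  toLex (m.toSyn (Cell.total c), toLex (wordCorank c, lengthRank c))

theorem wordCorank_lt {c d : Cell m a} (htot : Cell.total d = Cell.total c)
    (h : letterWord Set.univ c < letterWord Set.univ d) : wordCorank d < wordCorank c := by
  have hd : (letterWord Set.univ d).length ≤ (Cell.total c).degree :=
    (length_letterWord_le _ d).trans (htot ▸ d.length_le_degree_total)
  rw [wordCorank, wordCorank, htot]
  refine Set.ncard_lt_ncard ⟨fun l hl => ⟨hl.1, h.trans hl.2⟩, fun hsub => ?_⟩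
    ((List.finite_length_le _ _).subset fun l hl => hl.1)
  exact lt_irrefl _ (hsub ⟨hd, h⟩).2

theorem StdMerges.cellRank_lt {c d : Cell m a} (h : StdMerges m a c d)
    (hM : ¬ LetterMatching m a Set.univ c d) : cellRank d < cellRank c := by
  refine Prod.Lex.toLex_lt_toLex.2 (.inr ⟨by rw [StdMerges.total_eq h],
    Prod.Lex.toLex_lt_toLex.2 ?_⟩)
  rcases StdMerges.letterWord_lt_or h Set.univ with hlt | ⟨heq, hor⟩
  · exact .inl (wordCorank_lt (StdMerges.total_eq h) hlt)
  · refine .inr ⟨by simp only [wordCorank, heq, StdMerges.total_eq h], ?_⟩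
    have hlen := ListMerge.length_eq h
    simp only [lengthRank]
    by_cases hd : ∃ e, LetterMatching m a Set.univ e d
    · rw [if_pos hd, if_pos ((hor hd).resolve_left hM)]
      omega
    · rw [if_neg hd]
      omega

theorem LetterMatching.cellRank_lt {c d : Cell m a} (h : LetterMatching m a Set.univ c d) :
    cellRank c < cellRank d := by
  obtain ⟨j, h⟩ := h
  have htot := StdMerges.total_eq h.stdMerges
  refine Prod.Lex.toLex_lt_toLex.2 (.inr ⟨by rw [htot], Prod.Lex.toLex_lt_toLex.2 (.inr ⟨?_, ?_⟩)⟩)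
  · simp only [wordCorank, h.letterWord_eq, htot]
  · have hlen := ListMerge.length_eq h.stdMerges
    have hc : ¬ ∃ e, LetterMatching m a Set.univ e c :=
      fun ⟨e, _, he⟩ => he.not_source_of_target h
    simp only [lengthRank]
    rw [if_neg hc, if_pos ⟨c, j, h⟩]
    omega

theorem cellRank_lt_of_step {c d : Cell m a}
    (h : AlgMorse.Step (barD m a) (LetterMatching m a Set.univ) c d) : cellRank d < cellRank c := by
  rcases h with ⟨hD, hM⟩ | hM
  · rcases Merges.of_barD_ne_zero hD with ⟨w, rfl⟩ | h
    · refine Prod.Lex.toLex_lt_toLex.2 (.inl (m.toSyn_strictMono ?_))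
      exact lt_add_of_pos_left _ (pos_iff_ne_zero.2 w.2.1)
    · rcases Merges.total_lt_or_stdMerges h with hlt | h
      · exact Prod.Lex.toLex_lt_toLex.2 (.inl hlt)
      · exact StdMerges.cellRank_lt h hM
  · exact hM.cellRank_lt

theorem wellFounded_step :
    WellFounded (Function.swap (AlgMorse.Step (barD m a) (LetterMatching m a Set.univ))) :=
  Subrelation.wf cellRank_lt_of_step (InvImage.wf cellRank wellFounded_lt)

end Acyclicity

/-! ## Identification of the two matchings -/

section Remaining

variable {m : MonomialOrder (Fin n)} {a : Ideal (MvPolynomial (Fin n) k)}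

variable (m a) in
/-- The cells that lie on no edge in the first `j` positions: their first `j` entries are allowed
letters and the next entry contains an allowed letter. -/
def LetterRemaining : ℕ → Set (Fin n) → Cell m a → Prop
  | _, _, [] => True
  | 0, L, w :: _ => (lettersIn L w.1).Nonempty
  | j + 1, L, w :: c =>
    ∃ i ∈ L, w.1 = Finsupp.single i 1 ∧ LetterRemaining j (nextLetters m a L i) c

theorem letterRemaining_nil (j : ℕ) (L : Set (Fin n)) :
    LetterRemaining m a j L ([] : Cell m a) := by
  simp only [LetterRemaining]

theorem letterRemaining_succ_cons_iff {j : ℕ} {L : Set (Fin n)} {w : StdMon m a} {i : Fin n}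
    (hi : i ∈ L) (hw : w.1 = Finsupp.single i 1) (c : Cell m a) :
    LetterRemaining m a (j + 1) L (w :: c) ↔ LetterRemaining m a j (nextLetters m a L i) c := by
  constructor
  · rintro ⟨i', -, hw', h⟩
    obtain rfl := eq_of_eq_single hw hw'
    exact h
  · exact fun h => ⟨i, hi, hw, h⟩

theorem letterRemaining_zero_univ (c : Cell m a) : LetterRemaining m a 0 Set.univ c := by
  match c with
  | [] => exact letterRemaining_nil 0 _
  | w :: c =>
    obtain ⟨i, hi⟩ := Finsupp.ne_iff.1 w.2.1
    exact ⟨i, trivial, hi⟩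

theorem LetterRemaining.degree_total {c : Cell m a} {L : Set (Fin n)}
    (h : LetterRemaining m a c.length L c) : (Cell.total c).degree = c.length := by
  induction c generalizing L with
  | nil => simp
  | cons w c ih =>
    obtain ⟨i, -, hw, h⟩ := h
    rw [Cell.total_cons, map_add, hw, Finsupp.degree_single, ih h, List.length_cons, add_comm]

theorem isCritical_letterMatchingAt_nil (j : ℕ) (L : Set (Fin n)) :
    AlgMorse.IsCritical (LetterMatchingAt m a j L) [] :=
  fun _ => ⟨nofun, nofun⟩

theorem isCritical_letterMatchingAt_zero_cons_iff (hq : HasQuadraticInitialIdeal m a)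
    {L : Set (Fin n)} {w : StdMon m a} {c : Cell m a} (hL : (lettersIn L w.1).Nonempty) :
    AlgMorse.IsCritical (LetterMatchingAt m a 0 L) (w :: c) ↔
      LetterRemaining m a 1 L (w :: c) := by
  constructor
  · intro hc
    obtain ⟨i, hi⟩ := exists_isLeast_lettersIn hL
    have hw : w.1 = Finsupp.single i 1 := by
      by_contra hne
      obtain ⟨u, v, hu, hw⟩ := w.exists_eq_single_add hi.1.2 hne
      exact (hc _).2 (.head hi hu hw)
    refine ⟨i, hi.1.1, hw, ?_⟩
    match c, hc with
    | [], _ => exact letterRemaining_nil 0 _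
    | v :: q, hc =>
      refine Set.nonempty_iff_ne_empty.2 fun hemp => ?_
      have hne : w.1 + v.1 ≠ 0 := fun h0 => w.2.1 (add_eq_zero.1 h0).1
      let wv : StdMon m a := ⟨w.1 + v.1, hne, hq.isStandard_add hw hemp⟩
      exact (hc (wv :: q)).1 (.head (isLeast_lettersIn_add hi.1.1 hw hemp) hw rfl)
  · rintro ⟨i, hi, hw, hc⟩ d
    constructor
    · rintro (⟨hi', hu, hw'⟩ | _)
      obtain rfl := eq_of_eq_single hw hu
      exact hc.ne_empty (lettersIn_nextLetters_eq_empty hi' hu hw')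
    · rintro (⟨_, _, hw'⟩ | _)
      exact StdMon.ne_single_of_eq_add hw' i hw

theorem isCritical_letterMatchingAt_succ_cons_iff {j : ℕ} {L : Set (Fin n)} {w : StdMon m a}
    {i : Fin n} (hi : i ∈ L) (hw : w.1 = Finsupp.single i 1) {c : Cell m a} :
    AlgMorse.IsCritical (LetterMatchingAt m a (j + 1) L) (w :: c) ↔
      AlgMorse.IsCritical (LetterMatchingAt m a j (nextLetters m a L i)) c := by
  constructor
  · exact fun hc d => ⟨fun h => (hc (w :: d)).1 (.cons hi hw h),
      fun h => (hc (w :: d)).2 (.cons hi hw h)⟩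
  · intro hc d
    constructor
    · rintro (_ | ⟨_, hw', h⟩)
      obtain rfl := eq_of_eq_single hw hw'
      exact (hc _).1 h
    · rintro (_ | ⟨_, hw', h⟩)
      obtain rfl := eq_of_eq_single hw hw'
      exact (hc _).2 h

theorem letterRemaining_succ_iff (hq : HasQuadraticInitialIdeal m a) {j : ℕ} {L : Set (Fin n)}
    {c : Cell m a} :
    LetterRemaining m a (j + 1) L c ↔
      LetterRemaining m a j L c ∧ AlgMorse.IsCritical (LetterMatchingAt m a j L) c := by
  induction c generalizing j L with
  | nil => simp only [letterRemaining_nil, isCritical_letterMatchingAt_nil, and_self]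
  | cons w c ih =>
    match j with
    | 0 =>
      have hL : LetterRemaining m a 1 L (w :: c) → LetterRemaining m a 0 L (w :: c) :=
        fun ⟨i, hi, hw, _⟩ => ⟨i, (isLeast_lettersIn_of_eq_single hi hw).1⟩
      rw [← and_iff_right_of_imp hL]
      exact and_congr_right fun h => (isCritical_letterMatchingAt_zero_cons_iff hq h).symm
    | j + 1 =>
      have hj : ∀ {j}, LetterRemaining m a (j + 1) L (w :: c) → ∃ i ∈ L, w.1 = Finsupp.single i 1 :=
        fun ⟨i, hi, hw, _⟩ => ⟨i, hi, hw⟩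
      by_cases h : ∃ i ∈ L, w.1 = Finsupp.single i 1
      · obtain ⟨i, hi, hw⟩ := h
        rw [letterRemaining_succ_cons_iff hi hw, letterRemaining_succ_cons_iff hi hw,
          isCritical_letterMatchingAt_succ_cons_iff hi hw, ih]
      · exact ⟨fun h' => (h (hj h')).elim, fun h' => (h (hj h'.1)).elim⟩

end Remaining

section Matching

variable {m : MonomialOrder (Fin n)} {a : Ideal (MvPolynomial (Fin n) k)}

theorem StdMon.eq_of_le_single {u v : StdMon m a} {i : Fin n} (hu : u.1 = Finsupp.single i 1)
    (h : v.1 ≤ u.1) : v = u := by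
  refine Subtype.ext (le_antisymm h ?_)
  obtain ⟨l, hl⟩ := Finsupp.ne_iff.1 v.2.1
  have hul := h l
  rw [hu] at hul ⊢
  obtain rfl : l = i := by
    by_contra hli
    rw [Finsupp.single_eq_of_ne hli] at hul
    exact hl (Nat.le_zero.1 hul)
  exact Finsupp.single_le_iff.2 (Nat.one_le_iff_ne_zero.2 hl)

theorem isSplitting_nil_iff {L : Set (Fin n)} {w : StdMon m a} (q : Cell m a) (u : StdMon m a) :
    IsSplitting m a {c | LetterRemaining m a 0 L c} [] w q u ↔
      ∃ i ∈ lettersIn L w.1, u.1 = Finsupp.single i 1 ∧ w.1 ≠ Finsupp.single i 1 := by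
  constructor
  · rintro ⟨⟨u', hw, i, hi, hui⟩, hmin⟩
    have hiw : i ∈ lettersIn L w.1 := ⟨hi, by simp [hw, hui]⟩
    have hne : w.1 ≠ Finsupp.single i 1 := StdMon.ne_single_of_eq_add hw i
    obtain ⟨x, v, hx, hv⟩ := w.exists_eq_single_add hiw.2 hne
    have hxu : x.1 ≤ u.1 := by
      rw [hx]
      exact Finsupp.single_le_iff.2 (Nat.one_le_iff_ne_zero.2 hui)
    obtain rfl : x = u := by
      by_contra hne
      exact hmin x v hxu hne hv ⟨i, hi, by simp [hx]⟩
    exact ⟨i, hiw, hx, hne⟩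
  · rintro ⟨i, hi, hu, hne⟩
    obtain ⟨x, v, hx, hv⟩ := w.exists_eq_single_add hi.2 hne
    obtain rfl : u = x := Subtype.ext (hu.trans hx.symm)
    exact ⟨⟨v, hv, i, hi.1, by simp [hu]⟩, fun t _ htu htne _ =>
      (htne (StdMon.eq_of_le_single hu htu)).elim⟩

theorem isSplitting_cons_iff {j : ℕ} {L : Set (Fin n)} {x : StdMon m a} {i : Fin n} (hi : i ∈ L)
    (hx : x.1 = Finsupp.single i 1) (p : Cell m a) (w : StdMon m a) (q : Cell m a)
    (u : StdMon m a) :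
    IsSplitting m a {c | LetterRemaining m a (j + 1) L c} (x :: p) w q u ↔
      IsSplitting m a {c | LetterRemaining m a j (nextLetters m a L i) c} p w q u := by
  simp only [IsSplitting, List.cons_append, Set.mem_ofPred_eq, letterRemaining_succ_cons_iff hi hx]

section Nontrivial

variable [Nontrivial (QuotAlg a)]

theorem StdMerges.barD_ne_zero {c d : Cell m a} (h : StdMerges m a c d) : barD m a c d ≠ 0 :=
  (StdMerges.isUnit_barD h).ne_zero

theorem laterMatching_zero_iff
    (hvar : ∀ i j : Fin n, i < j → Finsupp.single j 1 ≺[m] Finsupp.single i 1)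
    {L : Set (Fin n)} {c d : Cell m a} :
    laterMatching m a 0 {c | LetterRemaining m a 0 L c} c d ↔ LetterMatchingAt m a 0 L c d := by
  constructor
  · rintro ⟨p, q, u, v, w, hp, rfl, rfl, hw, -, -, -, hs, hmax⟩
    obtain rfl := List.length_eq_zero_iff.1 hp
    obtain ⟨i, hi, hu, -⟩ := (isSplitting_nil_iff _ _).1 hs
    refine .head ⟨hi, fun l hl => ?_⟩ hu hw
    have hne : w.1 ≠ Finsupp.single l 1 := StdMon.ne_single_of_eq_add hw l
    obtain ⟨x, -, hx, -⟩ := w.exists_eq_single_add hl.2 hne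
    have hle := hmax x ((isSplitting_nil_iff _ _).2 ⟨l, hl, hx, hne⟩)
    rw [hx, hu] at hle
    exact not_lt.1 fun hli => hle.not_gt (hvar _ _ hli)
  · rintro @⟨_, u, v, w, q, i, hi, hu, hw⟩
    refine ⟨[], q, u, v, w, rfl, rfl, rfl, hw, StdMerges.barD_ne_zero (.head hw),
      ⟨i, hi.1.1, by simp [hu]⟩, ⟨i, hi.1⟩,
      (isSplitting_nil_iff _ _).2 ⟨i, hi.1, hu, StdMon.ne_single_of_eq_add hw i⟩, fun t ht => ?_⟩
    obtain ⟨l, hl, htl, -⟩ := (isSplitting_nil_iff _ _).1 ht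
    rw [htl, hu]
    rcases (hi.2 hl).lt_or_eq with h | rfl
    · exact (hvar _ _ h).le
    · exact le_rfl

theorem laterMatching_succ_cons_iff {j : ℕ} {L : Set (Fin n)} {x : StdMon m a} {i : Fin n}
    (hi : i ∈ L) (hx : x.1 = Finsupp.single i 1) {c d : Cell m a} :
    laterMatching m a (j + 1) {c | LetterRemaining m a (j + 1) L c} (x :: c) (x :: d) ↔
      laterMatching m a j {c | LetterRemaining m a j (nextLetters m a L i) c} c d := by
  constructor
  · rintro ⟨_ | ⟨y, p⟩, q, u, v, w, hp, hc, hd, hw, -, hcS, hdS, hs, hmax⟩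
    · cases hp
    obtain ⟨rfl, rfl⟩ := List.cons.inj hc
    obtain rfl := (List.cons.inj hd).2
    simp only [isSplitting_cons_iff hi hx] at hs hmax
    exact ⟨p, q, u, v, w, Nat.succ.inj hp, rfl, rfl, hw,
      StdMerges.barD_ne_zero (ListMerge.append_left hw p q),
      (letterRemaining_succ_cons_iff hi hx _).1 hcS, (letterRemaining_succ_cons_iff hi hx _).1 hdS,
      hs, hmax⟩
  · rintro ⟨p, q, u, v, w, hp, rfl, rfl, hw, -, hcS, hdS, hs, hmax⟩
    simp only [← isSplitting_cons_iff hi hx] at hs hmax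
    exact ⟨x :: p, q, u, v, w, congrArg _ hp, rfl, rfl, hw,
      StdMerges.barD_ne_zero (ListMerge.append_left hw (x :: p) q),
      (letterRemaining_succ_cons_iff hi hx _).2 hcS, (letterRemaining_succ_cons_iff hi hx _).2 hdS,
      hs, hmax⟩

theorem laterMatching_letterRemaining_iff
    (hvar : ∀ i j : Fin n, i < j → Finsupp.single j 1 ≺[m] Finsupp.single i 1)
    {j : ℕ} {L : Set (Fin n)} {c d : Cell m a} :
    laterMatching m a j {c | LetterRemaining m a j L c} c d ↔ LetterMatchingAt m a j L c d := by
  induction j generalizing L c d with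
  | zero => exact laterMatching_zero_iff hvar
  | succ j ih =>
    constructor
    · intro h
      obtain ⟨_ | ⟨x, p⟩, q, u, v, w, hp, rfl, rfl, -, -, hc, -⟩ := id h
      · cases hp
      obtain ⟨i, hi, hx, -⟩ := hc
      exact .cons hi hx (ih.1 ((laterMatching_succ_cons_iff hi hx).1 h))
    · rintro (_ | ⟨hi, hx, h⟩)
      exact (laterMatching_succ_cons_iff hi hx).2 (ih.2 h)

theorem firstMatching_iff {c d : Cell m a} :
    firstMatching m a c d ↔ LetterMatchingAt m a 0 Set.univ c d := by
  have hletters : ∀ w : Fin n →₀ ℕ, lettersIn Set.univ w = {l | w l ≠ 0} := fun w => by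
    simp only [lettersIn, Set.mem_univ, true_and]
  constructor
  · rintro ⟨x, w', w, q, i, rfl, rfl, -, hi, hx, hw⟩
    exact .head (by rwa [hletters]) hx hw
  · rintro @⟨_, u, v, w, q, i, hi, hu, hw⟩
    rw [hletters] at hi
    exact ⟨u, v, w, q, i, rfl, rfl, StdMerges.barD_ne_zero (.head hw), hi, hu, hw⟩

theorem matchingAt_letterRemaining_iff
    (hvar : ∀ i j : Fin n, i < j → Finsupp.single j 1 ≺[m] Finsupp.single i 1)
    {j : ℕ} {c d : Cell m a} :
    matchingAt m a j {c | LetterRemaining m a j Set.univ c} c d ↔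
      LetterMatchingAt m a j Set.univ c d := by
  match j with
  | 0 => exact firstMatching_iff
  | j + 1 => exact laterMatching_letterRemaining_iff hvar

end Nontrivial

theorem remaining_eq (hq : HasQuadraticInitialIdeal m a)
    (hvar : ∀ i j : Fin n, i < j → Finsupp.single j 1 ≺[m] Finsupp.single i 1) (j : ℕ) :
    remaining m a j = {c | LetterRemaining m a j Set.univ c} := by
  have := hq.nontrivial_quotAlg
  induction j with
  | zero => exact (Set.eq_univ_of_forall letterRemaining_zero_univ).symm
  | succ j ih =>
    ext c
    simp only [remaining, ih, Set.mem_ofPred_eq, letterRemaining_succ_iff hq, AlgMorse.IsCritical,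
      matchingAt_letterRemaining_iff hvar]

theorem matching_eq (hq : HasQuadraticInitialIdeal m a)
    (hvar : ∀ i j : Fin n, i < j → Finsupp.single j 1 ≺[m] Finsupp.single i 1) :
    matching m a = LetterMatching m a Set.univ := by
  have := hq.nontrivial_quotAlg
  ext c d
  simp only [matching, remaining_eq hq hvar, matchingAt_letterRemaining_iff hvar, LetterMatching]

theorem degree_total_of_isCritical (hq : HasQuadraticInitialIdeal m a) {c : Cell m a}
    (hc : AlgMorse.IsCritical (LetterMatching m a Set.univ) c) :
    (Cell.total c).degree = c.length := by
  have h (j : ℕ) : LetterRemaining m a j Set.univ c := by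
    induction j with
    | zero => exact letterRemaining_zero_univ c
    | succ j ih =>
      exact (letterRemaining_succ_iff hq).2
        ⟨ih, fun d => ⟨fun hd => (hc d).1 ⟨j, hd⟩, fun hd => (hc d).2 ⟨j, hd⟩⟩⟩
  exact (h c.length).degree_total

theorem isCritical_letterMatching_nil :
    AlgMorse.IsCritical (LetterMatching m a Set.univ) [] :=
  fun d => ⟨fun ⟨j, h⟩ => (isCritical_letterMatchingAt_nil j _ d).1 h,
    fun ⟨j, h⟩ => (isCritical_letterMatchingAt_nil j _ d).2 h⟩

theorem isMorseMatching_letterMatching [Nontrivial (QuotAlg a)] :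
    AlgMorse.IsMorseMatching (barD m a) (LetterMatching m a Set.univ) where
  edge _ _ := fun ⟨_, h⟩ => StdMerges.barD_ne_zero h.stdMerges
  matching _ _ _ _ _ := by
    rintro ⟨_, h⟩ ⟨_, h'⟩ (rfl | rfl) (rfl | rfl)
    · exact ⟨rfl, h.target_unique h'⟩
    · exact (h'.not_source_of_target h).elim
    · exact (h.not_source_of_target h').elim
    · exact ⟨h.source_unique h', rfl⟩
  invertible _ _ := fun ⟨_, h⟩ => StdMerges.isUnit_barD h.stdMerges
  acyclic c h := wellFounded_step.transGen.irrefl.irrefl c (by rwa [Relation.transGen_swap])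
  wellFounded := wellFounded_step

theorem Gam_mem_maxIdeal (ha : a.IsHomogeneous (MvPolynomial.homogeneousSubmodule (Fin n) k))
    {c e : Cell m a} (h : (Cell.total e).degree < (Cell.total c).degree) :
    AlgMorse.Gam (barD m a) (LetterMatching m a Set.univ) c e ∈ maxIdeal a := by
  refine AlgMorse.Gam_mem (t := fun c => (Cell.total c).degree) (fun c d _ hlt => ?_) h
  have hM : ¬ LetterMatching m a Set.univ d c := fun ⟨_, hM⟩ =>
    hlt.ne (congrArg Finsupp.degree (StdMerges.total_eq hM.stdMerges)).symm
  rw [AlgMorse.stepWeight, if_neg hM]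
  exact barD_mem_maxIdeal ha hlt

end Matching

section Resolution

variable {m : MonomialOrder (Fin n)} {a : Ideal (MvPolynomial (Fin n) k)}

theorem isMorseMatching_matching (hq : HasQuadraticInitialIdeal m a)
    (hvar : ∀ i j : Fin n, i < j → Finsupp.single j 1 ≺[m] Finsupp.single i 1) :
    AlgMorse.IsMorseMatching (barD m a) (matching m a) := by
  have := hq.nontrivial_quotAlg
  exact matching_eq hq hvar ▸ isMorseMatching_letterMatching

theorem augF_eq_comp_morseIncl :
    augF m a = ((maxIdeal a).mkQ ∘ₗ Finsupp.lapply []) ∘ₗ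
      AlgMorse.morseIncl (QuotAlg a) (matching m a) List.length 0 := by
  refine Finsupp.lhom_ext fun c r => ?_
  have hc : c.1 = [] := List.length_eq_zero_iff.1 c.2.2
  simp only [augF, Finsupp.linearCombination_single, LinearMap.comp_apply,
    AlgMorse.morseIncl_single, hc, Finsupp.lapply_apply, Finsupp.single_eq_same]
  exact congrArg (maxIdeal a).mkQ (mul_one r)

theorem augF_surjective (hq : HasQuadraticInitialIdeal m a)
    (hvar : ∀ i j : Fin n, i < j → Finsupp.single j 1 ≺[m] Finsupp.single i 1) :
    Function.Surjective (augF m a) := by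
  intro y
  obtain ⟨r, rfl⟩ := (maxIdeal a).mkQ_surjective y
  have hnil : AlgMorse.IsCritical (matching m a) [] :=
    matching_eq hq hvar ▸ isCritical_letterMatching_nil
  refine ⟨Finsupp.single ⟨[], hnil, rfl⟩ r, ?_⟩
  rw [augF, Finsupp.linearCombination_single]
  exact congrArg (maxIdeal a).mkQ (mul_one r)

theorem exact_dF_augF (hM : AlgMorse.IsMorseMatching (barD m a) (matching m a))
    (ha : a ≤ RingHom.ker (MvPolynomial.constantCoeff)) :
    Function.Exact (dF m a 0) (augF m a) := by
  rw [augF_eq_comp_morseIncl]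
  exact hM.exact_morseD_augmentation isGraded_barD (boundary_comp_boundary ha) _
    fun _ hx => mkQ_maxIdeal_apply_nil_eq_zero_iff ha hx

theorem exact_dF (hM : AlgMorse.IsMorseMatching (barD m a) (matching m a))
    (ha : a ≤ RingHom.ker (MvPolynomial.constantCoeff)) (i : ℕ) :
    Function.Exact (dF m a (i + 1)) (dF m a i) :=
  hM.exact_morseD isGraded_barD (boundary_comp_boundary ha) i
    fun _ hx h0 => mem_map_boundary_of_mem_chains_succ ha hx h0

theorem range_dF_le (hq : HasQuadraticInitialIdeal m a)
    (hvar : ∀ i j : Fin n, i < j → Finsupp.single j 1 ≺[m] Finsupp.single i 1)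
    (ha : a.IsHomogeneous (MvPolynomial.homogeneousSubmodule (Fin n) k)) (i : ℕ) :
    LinearMap.range (dF m a i) ≤ maxIdeal a • (⊤ : Submodule (QuotAlg a) (F m a i)) := by
  refine AlgMorse.range_morseD_le fun ⟨c, hc, hci⟩ ⟨e, he, hei⟩ => ?_
  change AlgMorse.Gam (barD m a) (matching m a) c e ∈ maxIdeal a
  rw [matching_eq hq hvar] at hc he ⊢
  refine Gam_mem_maxIdeal ha ?_
  rw [degree_total_of_isCritical hq hc, degree_total_of_isCritical hq he, hci, hei]
  exact Nat.lt_succ_self i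

end Resolution

end CommAnick

theorem corollary3p5_general {k : Type*} [Field k] {n : ℕ} (m : MonomialOrder (Fin n))
    (hvar : ∀ i j : Fin n, i < j → Finsupp.single j 1 ≺[m] Finsupp.single i 1)
    (a : Ideal (MvPolynomial (Fin n) k)) (B : Set (MvPolynomial (Fin n) k))
    (hB : CommAnick.IsGroebnerBasis m B a) (hquad : ∀ b ∈ B, b.IsHomogeneous 2) :
    AlgMorse.IsAcyclicMatching (CommAnick.barD m a) (CommAnick.matching m a) ∧
    (∀ c : CommAnick.Cell m a,
      {p | AlgMorse.IsPath (CommAnick.barD m a) (CommAnick.matching m a) p ∧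
        p.head? = some c}.Finite) ∧
    Function.Surjective (CommAnick.augF m a) ∧
    Function.Exact (CommAnick.dF m a 0) (CommAnick.augF m a) ∧
    (∀ i, Function.Exact (CommAnick.dF m a (i + 1)) (CommAnick.dF m a i)) ∧
    (∀ i, LinearMap.range (CommAnick.dF m a i) ≤
      CommAnick.maxIdeal a • (⊤ : Submodule (CommAnick.QuotAlg a) (CommAnick.F m a i))) := by
  have hq := hB.hasQuadraticInitialIdeal hquad
  have ha := hB.isHomogeneous fun b hb => ⟨2, hquad b hb⟩
  have := hq.nontrivial_quotAlg
  have haug := CommAnick.le_ker_constantCoeff ha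
  have hM := CommAnick.isMorseMatching_matching hq hvar
  exact ⟨hM.toIsAcyclicMatching, hM.finite_paths, CommAnick.augF_surjective hq hvar,
    CommAnick.exact_dF_augF hM haug, CommAnick.exact_dF hM haug,
    CommAnick.range_dF_le hq hvar ha⟩

theorem corollary3p5 {k : Type*} [Field k] {n : ℕ} (m : MonomialOrder (Fin n))
    (hdeg : CommAnick.IsDegreeOrder m)
    (hvar : ∀ i j : Fin n, i < j → Finsupp.single j 1 ≺[m] Finsupp.single i 1)
    (a : Ideal (MvPolynomial (Fin n) k)) (B : Set (MvPolynomial (Fin n) k))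
    (hB : CommAnick.IsGroebnerBasis m B a) (hquad : ∀ b ∈ B, b.IsHomogeneous 2) :
    -- the Morse complex is well defined: acyclic matching, only finitely many paths from each cell
    AlgMorse.IsAcyclicMatching (CommAnick.barD m a) (CommAnick.matching m a) ∧
    (∀ c : CommAnick.Cell m a,
      {p | AlgMorse.IsPath (CommAnick.barD m a) (CommAnick.matching m a) p ∧
        p.head? = some c}.Finite) ∧
    -- it is a resolution of the residue class field
    Function.Surjective (CommAnick.augF m a) ∧
    Function.Exact (CommAnick.dF m a 0) (CommAnick.augF m a) ∧
    (∀ i, Function.Exact (CommAnick.dF m a (i + 1)) (CommAnick.dF m a i)) ∧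
    -- which is minimal
    (∀ i, LinearMap.range (CommAnick.dF m a i) ≤
      CommAnick.maxIdeal a • (⊤ : Submodule (CommAnick.QuotAlg a) (CommAnick.F m a i))) :=
  corollary3p5_general m hvar a B hB hquad
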